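/- Let $G$ be a compact Lie group acting continuously on a compact Hausdorff space $X$, let $A$ be a unital Banach $\mathbb{R}$-algebra, and let $\mathcal{A}\to X$ be a locally trivial bundle of Banach $\mathbb{R}$-algebras with fibre $A$: every point of $X$ has an open neighbourhood $U$ with a homeomorphism $\mathcal{A}|_U\cong U\times A$ over $U$ that is an $\mathbb{R}$-algebra isomorphism on each fibre. Assume that $G$ acts continuously on $\mathcal{A}$, each $g\in G$ mapping $\mathcal{A}_x$ to $\mathcal{A}_{gx}$ by an algebra isomorphism. A $G$–$\mathcal{A}$ bundle on $X$ is a bundle $E\to X$ of left $\mathcal{A}$-modules such that $\mathcal{A}\times_X E\to E$ is continuous, each fibre $E_x$ is a finitely generated projective $\mathcal{A}_x$-module, and locally on $X$ the pair $(\mathcal{A},E)$ is isomorphic to $(U\times A,\,U\times P)$ for some (finitely generated projective) $A$-module $P$ with its canonical topology, where $P$ may depend on $U$; together with a continuous action of $G$ on $E$, each $g$ mapping $E_x$ additively to $E_{gx}$, with $g(a\cdot e)=g(a)\cdot g(e)$ for $a\in\mathcal{A}_x$, $e\in E_x$. Morphisms are the continuous bundle maps over $X$ that are $\mathcal{A}_x$-linear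 on each fibre and commute with $G$. Let $B=\Gamma(\mathcal{A})$ be the Banach algebra of continuous sections of $\mathcal{A}$ (with the compact-open topology, i.e. uniform convergence in local trivializations), on which $G$ acts by $(g\cdot b)(x)=g\bigl(b(g^{-1}x)\bigr)$. A finitely generated projective $B$-module with a continuous $G$-action is a finitely generated projective left $B$-module $M$ with an action of $G$ by additive maps such that $g(b\cdot m)=g(b)\cdot g(m)$ and such that $G\times M\to M$ is continuous for the canonical topology of $M$ (the quotient topology from any surjection $B^n\to M$). Morphisms are the $B$-linear $G$-equivariant maps. Theorem. For every $G$–$\mathcal{A}$ bundle $E$, the $B$-module $\Gamma(E)$ of continuous sections, with the $G$-action $(g\cdot s)(x)=g\bigl(s(g^{-1}x)\bigr)$, is a finitely generated projective $B$-module with a continuous $G$-action, and the functor $\Gamma$ is an equivalence from the category of $G$–$\mathcal{A}$ bundles on $X$ to the category of finitely generated projective $B$-modules with a continuous $G$-action. -/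

import Mathlib

open CategoryTheory Topology
open scoped ContDiff Manifold

universe u v w t

/-- A locally trivial bundle of Banach `ℝ`-algebras with model fibre `A`: a family of algebras
with a topology on the total space, such that every point has a neighbourhood `U` over which the
total space is homeomorphic to `U × A`, by a homeomorphism over `U` that is an algebra
isomorphism on each fibre.  (So the structure group is the group of continuous algebra
automorphisms of `A`, acting jointly continuously.) -/
structure AlgebraBundle (X : Type u) [TopologicalSpace X] (A : Type v) [NormedRing A]
    [NormedAlgebra ℝ A] where
  /-- the fibres -/
  Fiber : X → Type v
  [ring : ∀ x, Ring (Fiber x)]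
  [algebra : ∀ x, Algebra ℝ (Fiber x)]
  [topology : TopologicalSpace (Bundle.TotalSpace A Fiber)]
  locally_trivial : ∀ x₀ : X,
    ∃ e : Bundle.Trivialization A (Bundle.TotalSpace.proj : Bundle.TotalSpace A Fiber → X),
      x₀ ∈ e.baseSet ∧
      ∀ y ∈ e.baseSet, ∃ φ : Fiber y ≃ₐ[ℝ] A, ∀ a : Fiber y, e ⟨y, a⟩ = (y, φ a)

attribute [instance] AlgebraBundle.ring AlgebraBundle.algebra AlgebraBundle.topology

/-- The total space of an algebra bundle. -/
abbrev AlgebraBundle.Total {X : Type u} [TopologicalSpace X] {A : Type v} [NormedRing A]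
    [NormedAlgebra ℝ A] (𝒜 : AlgebraBundle X A) : Type (max u v) :=
  Bundle.TotalSpace A 𝒜.Fiber

/-- An algebra bundle on the `G`-space `X` on which `G` acts: `g` maps `𝒜_x` to `𝒜_{g x}` by an
algebra isomorphism, and the action map `G × 𝒜 → 𝒜` is continuous.  To avoid casts between
fibres, the map `𝒜_x → 𝒜_{g x}` is written `𝒜_x → 𝒜_y` with a proof of `g • x = y`. -/
structure GAlgebraBundle (G : Type w) [Group G] [TopologicalSpace G] (X : Type u)
    [TopologicalSpace X] [MulAction G X] (A : Type v) [NormedRing A] [NormedAlgebra ℝ A]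
    extends AlgebraBundle X A where
  act : ∀ (g : G) {x y : X}, g • x = y → (Fiber x ≃ₐ[ℝ] Fiber y)
  act_one : ∀ {x : X} (h : (1 : G) • x = x) (a : Fiber x), act 1 h a = a
  act_mul : ∀ (g₁ g₂ : G) {x y z : X} (h₂ : g₂ • x = y) (h₁ : g₁ • y = z)
    (h : (g₁ * g₂) • x = z) (a : Fiber x), act (g₁ * g₂) h a = act g₁ h₁ (act g₂ h₂ a)
  continuous_act : Continuous fun p : G × toAlgebraBundle.Total ↦
    (⟨p.1 • p.2.proj, act p.1 rfl p.2.snd⟩ : toAlgebraBundle.Total)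

/-- An `𝒜`-bundle: a locally trivial bundle `E` of left `𝒜`-modules with continuous scalar
multiplication `𝒜 ×_X E → E`, all of whose fibres are finitely generated projective.
Local triviality: every point has a neighbourhood over which the pair `(𝒜, E)` is isomorphic to
a product pair `(U × A, U × P)`, where `P` is an `A`-module with its canonical topology (for a
finitely generated projective module, the quotient topology from any surjection `Aⁿ → P`).
The model `P` may depend on the neighbourhood. -/
structure ModuleBundle {X : Type u} [TopologicalSpace X] {A : Type v} [NormedRing A]
    [NormedAlgebra ℝ A] (𝒜 : AlgebraBundle X A) where
  /-- the fibres -/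
  Fiber : X → Type v
  [addCommGroup : ∀ x, AddCommGroup (Fiber x)]
  [module : ∀ x, Module (𝒜.Fiber x) (Fiber x)]
  [topology : TopologicalSpace (Bundle.TotalSpace Unit Fiber)]
  locally_trivial : ∀ x₀ : X,
    ∃ (P : Type v) (_ : AddCommGroup P) (_ : Module A P) (_ : TopologicalSpace P)
      (_ : IsModuleTopology A P)
      (e : Bundle.Trivialization A (Bundle.TotalSpace.proj : 𝒜.Total → X))
      (f : Bundle.Trivialization P (Bundle.TotalSpace.proj : Bundle.TotalSpace Unit Fiber → X)),
      x₀ ∈ e.baseSet ∧ e.baseSet = f.baseSet ∧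
      ∀ y ∈ e.baseSet, ∃ (φ : 𝒜.Fiber y ≃ₐ[ℝ] A) (ψ : Fiber y ≃+ P),
        (∀ a : 𝒜.Fiber y, e ⟨y, a⟩ = (y, φ a)) ∧ (∀ m : Fiber y, f ⟨y, m⟩ = (y, ψ m)) ∧
        ∀ (a : 𝒜.Fiber y) (m : Fiber y), ψ (a • m) = φ a • ψ m
  continuous_smul : Continuous
    fun p : {p : 𝒜.Total × Bundle.TotalSpace Unit Fiber // p.2.proj = p.1.proj} ↦
      (⟨p.1.1.proj, p.1.1.snd • (p.2 ▸ p.1.2.snd : Fiber p.1.1.proj)⟩ :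
        Bundle.TotalSpace Unit Fiber)
  finite : ∀ x, Module.Finite (𝒜.Fiber x) (Fiber x)
  projective : ∀ x, Module.Projective (𝒜.Fiber x) (Fiber x)

attribute [instance] ModuleBundle.addCommGroup ModuleBundle.module ModuleBundle.topology

/-- The total space of an `𝒜`-bundle. -/
abbrev ModuleBundle.Total {X : Type u} [TopologicalSpace X] {A : Type v} [NormedRing A]
    [NormedAlgebra ℝ A] {𝒜 : AlgebraBundle X A} (E : ModuleBundle 𝒜) : Type (max u v) :=
  Bundle.TotalSpace Unit E.Fiber

/-- A `G`–`𝒜` bundle: an `𝒜`-bundle `E` with a continuous action of `G` on the total space that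
is additive from `E_x` to `E_{g x}` and satisfies `g (a • e) = g a • g e`. -/
structure GBundle {G : Type w} [Group G] [TopologicalSpace G] {X : Type u}
    [TopologicalSpace X] [MulAction G X] {A : Type v} [NormedRing A] [NormedAlgebra ℝ A]
    (𝒜 : GAlgebraBundle G X A) extends ModuleBundle 𝒜.toAlgebraBundle where
  act : ∀ (g : G) {x y : X}, g • x = y → (Fiber x →+ Fiber y)
  act_one : ∀ {x : X} (h : (1 : G) • x = x) (m : Fiber x), act 1 h m = m
  act_mul : ∀ (g₁ g₂ : G) {x y z : X} (h₂ : g₂ • x = y) (h₁ : g₁ • y = z)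
    (h : (g₁ * g₂) • x = z) (m : Fiber x), act (g₁ * g₂) h m = act g₁ h₁ (act g₂ h₂ m)
  act_smul : ∀ (g : G) {x y : X} (h : g • x = y) (a : 𝒜.Fiber x) (m : Fiber x),
    act g h (a • m) = 𝒜.act g h a • act g h m
  continuous_act : Continuous fun p : G × toModuleBundle.Total ↦
    (⟨p.1 • p.2.proj, act p.1 rfl p.2.snd⟩ : toModuleBundle.Total)

section

variable {G : Type w} [Group G] [TopologicalSpace G] {X : Type u} [TopologicalSpace X]
  [MulAction G X] {A : Type v} [NormedRing A] [NormedAlgebra ℝ A]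

/-- Morphisms of `G`–`𝒜` bundles: continuous bundle maps over `X` that are module maps on the
fibres and commute with the action of `G`. -/
@[ext]
structure GBundle.Hom {𝒜 : GAlgebraBundle G X A} (E F : GBundle 𝒜) where
  toFun : ∀ x, E.Fiber x →ₗ[𝒜.Fiber x] F.Fiber x
  continuous_toFun : Continuous fun p : E.Total ↦ (⟨p.proj, toFun p.proj p.snd⟩ : F.Total)
  map_act : ∀ (g : G) {x y : X} (h : g • x = y) (m : E.Fiber x),
    toFun y (E.act g h m) = F.act g h (toFun x m)

/-- The category of `G`–`𝒜` bundles. -/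
instance GBundle.category (𝒜 : GAlgebraBundle G X A) : Category (GBundle 𝒜) where
  Hom E F := GBundle.Hom E F
  id E :=
    { toFun := fun _ ↦ LinearMap.id
      continuous_toFun := continuous_id
      map_act := fun _ _ _ _ _ ↦ rfl }
  comp f g :=
    { toFun := fun x ↦ (g.toFun x).comp (f.toFun x)
      continuous_toFun := g.continuous_toFun.comp f.continuous_toFun
      map_act := fun k x y h m ↦ by
        simp only [LinearMap.comp_apply, f.map_act, g.map_act] }

/-! ### Continuous sections -/

theorem AlgebraBundle.continuous_section₂ (𝒜 : AlgebraBundle X A) {s t r : ∀ x, 𝒜.Fiber x}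
    (hs : Continuous fun x ↦ (⟨x, s x⟩ : 𝒜.Total)) (ht : Continuous fun x ↦ (⟨x, t x⟩ : 𝒜.Total))
    (op : A → A → A) (hop : Continuous fun p : A × A ↦ op p.1 p.2)
    (hr : ∀ (x : X) (φ : 𝒜.Fiber x ≃ₐ[ℝ] A), φ (r x) = op (φ (s x)) (φ (t x))) :
    Continuous fun x ↦ (⟨x, r x⟩ : 𝒜.Total) := by
  rw [continuous_iff_continuousAt]
  intro x₀
  obtain ⟨e, hx₀, he⟩ := 𝒜.locally_trivial x₀
  have key : ∀ q : ∀ x, 𝒜.Fiber x, Continuous (fun x ↦ (⟨x, q x⟩ : 𝒜.Total)) →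
      ContinuousAt (fun x ↦ e ⟨x, q x⟩) x₀ := fun q hq ↦
    ContinuousAt.comp (f := fun x ↦ (⟨x, q x⟩ : 𝒜.Total)) (g := e)
      (e.continuousAt (e.mem_source.2 hx₀)) hq.continuousAt
  refine e.continuousAt_of_comp_left continuousAt_id hx₀ ?_
  have h : ContinuousAt (fun x ↦ (x, op (e ⟨x, s x⟩).2 (e ⟨x, t x⟩).2)) x₀ :=
    continuousAt_id.prodMk (hop.continuousAt.comp
      ((key s hs).snd.prodMk (key t ht).snd))
  refine h.congr ?_
  filter_upwards [e.open_baseSet.mem_nhds hx₀] with y hy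
  obtain ⟨φ, hφ⟩ := he y hy
  simp [hφ, hr y φ]

/-- The algebra `B = Γ(𝒜)` of continuous sections of an algebra bundle, as a subalgebra of the
product of the fibres. -/
def AlgebraBundle.sections (𝒜 : AlgebraBundle X A) : Subalgebra ℝ (∀ x, 𝒜.Fiber x) where
  carrier := {s | Continuous fun x ↦ (⟨x, s x⟩ : 𝒜.Total)}
  add_mem' {s t} hs ht := 𝒜.continuous_section₂ hs ht (· + ·) continuous_add
    fun x φ ↦ by simp
  mul_mem' {s t} hs ht := 𝒜.continuous_section₂ hs ht (· * ·) continuous_mul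
    fun x φ ↦ by simp
  algebraMap_mem' c := by
    change Continuous fun x ↦ (⟨x, algebraMap ℝ (∀ x, 𝒜.Fiber x) c x⟩ : 𝒜.Total)
    rw [continuous_iff_continuousAt]
    intro x₀
    obtain ⟨e, hx₀, he⟩ := 𝒜.locally_trivial x₀
    refine e.continuousAt_of_comp_left continuousAt_id hx₀ ?_
    have h : ContinuousAt (fun x : X ↦ (x, algebraMap ℝ A c)) x₀ :=
      continuousAt_id.prodMk continuousAt_const
    refine h.congr ?_
    filter_upwards [e.open_baseSet.mem_nhds hx₀] with y hy
    obtain ⟨φ, hφ⟩ := he y hy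
    simp [hφ]

/-- A continuous section, as a continuous map from `X` to the total space. -/
def AlgebraBundle.sections.toContinuousMap (𝒜 : AlgebraBundle X A) (s : 𝒜.sections) :
    C(X, 𝒜.Total) where
  toFun x := ⟨x, s.1 x⟩
  continuous_toFun := s.2

/-- The topology of `Γ(𝒜)`: the compact-open topology.  For compact `X` this is the topology of
uniform convergence in local trivializations, that is, the topology of the Banach algebra
`Γ(𝒜)`. -/
instance AlgebraBundle.sections.instTopologicalSpace (𝒜 : AlgebraBundle X A) :
    TopologicalSpace 𝒜.sections :=
  TopologicalSpace.induced (AlgebraBundle.sections.toContinuousMap 𝒜) inferInstance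

theorem GAlgebraBundle.act_congr (𝒜 : GAlgebraBundle G X A) {g g' : G} (hg : g = g')
    {x x' y : X} (hx : x = x') (h : g • x = y) (h' : g' • x' = y) (s : ∀ x, 𝒜.Fiber x) :
    𝒜.act g h (s x) = 𝒜.act g' h' (s x') := by
  subst hg; subst hx; rfl

theorem GBundle.act_congr {𝒜 : GAlgebraBundle G X A} (E : GBundle 𝒜) {g g' : G} (hg : g = g')
    {x x' y : X} (hx : x = x') (h : g • x = y) (h' : g' • x' = y) (s : ∀ x, E.Fiber x) :
    E.act g h (s x) = E.act g' h' (s x') := by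
  subst hg; subst hx; rfl

variable [ContinuousSMul G X]

/-- `G` acts on `Γ(𝒜)` by ring automorphisms, `(g • b)(x) = g (b (g⁻¹ x))`. -/
instance GAlgebraBundle.mulSemiringAction (𝒜 : GAlgebraBundle G X A) :
    MulSemiringAction G 𝒜.sections where
  smul g b := ⟨fun x ↦ 𝒜.act g (smul_inv_smul g x) (b.1 (g⁻¹ • x)), by
    have h := 𝒜.continuous_act.comp
      ((continuous_const (y := g)).prodMk (b.2.comp (continuous_const_smul g⁻¹)))
    refine h.congr fun x ↦ ?_
    have key : ∀ (y : X) (hy : g • g⁻¹ • x = y),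
        (⟨g • g⁻¹ • x, 𝒜.act g rfl (b.1 (g⁻¹ • x))⟩ : 𝒜.Total) =
          ⟨y, 𝒜.act g hy (b.1 (g⁻¹ • x))⟩ := by
      rintro y rfl; rfl
    exact key x (smul_inv_smul g x)⟩
  one_smul b := Subtype.ext <| funext fun x ↦
    (𝒜.act_congr rfl (by simp) _ (one_smul G x) b.1).trans (𝒜.act_one _ _)
  mul_smul g₁ g₂ b := Subtype.ext <| funext fun x ↦ by
    change 𝒜.act (g₁ * g₂) _ (b.1 ((g₁ * g₂)⁻¹ • x)) =
      𝒜.act g₁ _ (𝒜.act g₂ _ (b.1 (g₂⁻¹ • g₁⁻¹ • x)))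
    rw [← 𝒜.act_mul g₁ g₂ _ _ (by simp [mul_smul])]
    exact 𝒜.act_congr rfl (by simp [mul_smul]) _ _ b.1
  smul_zero g := Subtype.ext <| funext fun x ↦ map_zero (𝒜.act g _)
  smul_add g b c := Subtype.ext <| funext fun x ↦ map_add (𝒜.act g _) _ _
  smul_one g := Subtype.ext <| funext fun x ↦ map_one (𝒜.act g _)
  smul_mul g b c := Subtype.ext <| funext fun x ↦ map_mul (𝒜.act g _) _ _


theorem ModuleBundle.continuous_add_section {𝒜 : AlgebraBundle X A} (E : ModuleBundle 𝒜)
    {s t : ∀ x, E.Fiber x} (hs : Continuous fun x ↦ (⟨x, s x⟩ : E.Total))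
    (ht : Continuous fun x ↦ (⟨x, t x⟩ : E.Total)) :
    Continuous fun x ↦ (⟨x, s x + t x⟩ : E.Total) := by
  rw [continuous_iff_continuousAt]
  intro x₀
  obtain ⟨P, _, _, _, _, e, f, hx₀, hef, h⟩ := E.locally_trivial x₀
  have : ContinuousAdd P := IsModuleTopology.toContinuousAdd A P
  rw [hef] at hx₀ h
  have key : ∀ q : ∀ x, E.Fiber x, Continuous (fun x ↦ (⟨x, q x⟩ : E.Total)) →
      ContinuousAt (fun x ↦ f ⟨x, q x⟩) x₀ := fun q hq ↦
    ContinuousAt.comp (f := fun x ↦ (⟨x, q x⟩ : E.Total)) (g := f)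
      (f.continuousAt (f.mem_source.2 hx₀)) hq.continuousAt
  refine f.continuousAt_of_comp_left continuousAt_id hx₀ ?_
  have hc : ContinuousAt (fun x ↦ (x, (f ⟨x, s x⟩).2 + (f ⟨x, t x⟩).2)) x₀ :=
    continuousAt_id.prodMk ((key s hs).snd.add (key t ht).snd)
  refine hc.congr ?_
  filter_upwards [f.open_baseSet.mem_nhds hx₀] with y hy
  obtain ⟨φ, ψ, -, hψ, -⟩ := h y hy
  simp [hψ]

theorem ModuleBundle.continuous_zero_section {𝒜 : AlgebraBundle X A} (E : ModuleBundle 𝒜) :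
    Continuous fun x ↦ (⟨x, 0⟩ : E.Total) := by
  rw [continuous_iff_continuousAt]
  intro x₀
  obtain ⟨P, _, _, _, _, e, f, hx₀, hef, h⟩ := E.locally_trivial x₀
  rw [hef] at hx₀ h
  refine f.continuousAt_of_comp_left continuousAt_id hx₀ ?_
  have hc : ContinuousAt (fun x : X ↦ (x, (0 : P))) x₀ :=
    continuousAt_id.prodMk continuousAt_const
  refine hc.congr ?_
  filter_upwards [f.open_baseSet.mem_nhds hx₀] with y hy
  obtain ⟨φ, ψ, -, hψ, -⟩ := h y hy
  simp [hψ]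

theorem ModuleBundle.continuous_smul_section {𝒜 : AlgebraBundle X A} (E : ModuleBundle 𝒜)
    {b : ∀ x, 𝒜.Fiber x} {s : ∀ x, E.Fiber x} (hb : Continuous fun x ↦ (⟨x, b x⟩ : 𝒜.Total))
    (hs : Continuous fun x ↦ (⟨x, s x⟩ : E.Total)) :
    Continuous fun x ↦ (⟨x, b x • s x⟩ : E.Total) :=
  E.continuous_smul.comp (f := fun x ↦
    (⟨(⟨x, b x⟩, ⟨x, s x⟩), rfl⟩ : {p : 𝒜.Total × E.Total // p.2.proj = p.1.proj}))
    ((hb.prodMk hs).subtype_mk _)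

/-- The `Γ(𝒜)`-module `Γ(E)` of continuous sections of an `𝒜`-bundle, with pointwise
operations. -/
def ModuleBundle.sections {𝒜 : AlgebraBundle X A} (E : ModuleBundle 𝒜) :
    Submodule 𝒜.sections (∀ x, E.Fiber x) where
  carrier := {s | Continuous fun x ↦ (⟨x, s x⟩ : E.Total)}
  add_mem' hs ht := E.continuous_add_section hs ht
  zero_mem' := E.continuous_zero_section
  smul_mem' b _ hs := E.continuous_smul_section b.2 hs

/-- `G` acts on `Γ(E)` by `(g • s)(x) = g (s (g⁻¹ x))`. -/
instance GBundle.distribMulAction {𝒜 : GAlgebraBundle G X A} (E : GBundle 𝒜) :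
    DistribMulAction G E.sections where
  smul g s := ⟨fun x ↦ E.act g (smul_inv_smul g x) (s.1 (g⁻¹ • x)), by
    have h := E.continuous_act.comp
      ((continuous_const (y := g)).prodMk (s.2.comp (continuous_const_smul g⁻¹)))
    refine h.congr fun x ↦ ?_
    have key : ∀ (y : X) (hy : g • g⁻¹ • x = y),
        (⟨g • g⁻¹ • x, E.act g rfl (s.1 (g⁻¹ • x))⟩ : E.Total) =
          ⟨y, E.act g hy (s.1 (g⁻¹ • x))⟩ := by
      rintro y rfl; rfl
    exact key x (smul_inv_smul g x)⟩
  one_smul s := Subtype.ext <| funext fun x ↦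
    (E.act_congr rfl (by simp) _ (one_smul G x) s.1).trans (E.act_one _ _)
  mul_smul g₁ g₂ s := Subtype.ext <| funext fun x ↦ by
    change E.act (g₁ * g₂) _ (s.1 ((g₁ * g₂)⁻¹ • x)) =
      E.act g₁ _ (E.act g₂ _ (s.1 (g₂⁻¹ • g₁⁻¹ • x)))
    rw [← E.act_mul g₁ g₂ _ _ (by simp [mul_smul])]
    exact E.act_congr rfl (by simp [mul_smul]) _ _ s.1
  smul_zero g := Subtype.ext <| funext fun x ↦ map_zero (E.act g _)
  smul_add g s s' := Subtype.ext <| funext fun x ↦ map_add (E.act g _) _ _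

end

/-! ### Modules with a `G`-action -/

/-- A left `B`-module with an action of `G` by additive maps, such that
`g (b • m) = g b • g m`. -/
structure EquivariantModule (G : Type w) [Group G] (B : Type u) [Ring B]
    [MulSemiringAction G B] where
  carrier : Type v
  [addCommGroup : AddCommGroup carrier]
  [module : Module B carrier]
  [action : DistribMulAction G carrier]
  smul_smul : ∀ (g : G) (b : B) (m : carrier), g • (b • m) = (g • b) • (g • m)

attribute [instance] EquivariantModule.addCommGroup EquivariantModule.module
  EquivariantModule.action

/-- Morphisms: `B`-linear maps that commute with the action of `G`. -/
@[ext]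
structure EquivariantModule.Hom {G : Type w} [Group G] {B : Type u} [Ring B]
    [MulSemiringAction G B] (M N : EquivariantModule.{u, v, w} G B) where
  toLinearMap : M.carrier →ₗ[B] N.carrier
  map_smul : ∀ (g : G) (m : M.carrier), toLinearMap (g • m) = g • toLinearMap m

instance EquivariantModule.category (G : Type w) [Group G] (B : Type u) [Ring B]
    [MulSemiringAction G B] : Category (EquivariantModule.{u, v, w} G B) where
  Hom M N := EquivariantModule.Hom M N
  id M := { toLinearMap := LinearMap.id, map_smul := fun _ _ ↦ rfl }
  comp f g :=
    { toLinearMap := g.toLinearMap.comp f.toLinearMap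
      map_smul := fun k m ↦ by simp only [LinearMap.comp_apply, f.map_smul, g.map_smul] }

/-- The property of being a finitely generated projective `B`-module on which `G` acts
continuously, i.e. such that `G × M → M` is continuous for the canonical topology of `M` (the
module topology, which for finitely generated `M` is the quotient topology from any surjection
`Bⁿ → M`). -/
def EquivariantModule.IsFGProjectiveContinuous (G : Type w) [Group G] [TopologicalSpace G]
    (B : Type u) [Ring B] [TopologicalSpace B] [MulSemiringAction G B] :
    ObjectProperty (EquivariantModule.{u, v, w} G B) := fun M ↦
  Module.Finite B M.carrier ∧ Module.Projective B M.carrier ∧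
    letI : TopologicalSpace M.carrier := moduleTopology B M.carrier
    Continuous fun p : G × M.carrier ↦ p.1 • p.2

/-! ### The functor of sections -/

/-- The functor `Γ`, which sends a `G`–`𝒜` bundle `E` to the `Γ(𝒜)`-module `Γ(E)` with its
action of `G`, and a morphism `f` to `s ↦ f ∘ s`. -/
def GBundle.sectionsFunctor {G : Type w} [Group G] [TopologicalSpace G] {X : Type u}
    [TopologicalSpace X] [MulAction G X] [ContinuousSMul G X] {A : Type v} [NormedRing A]
    [NormedAlgebra ℝ A] (𝒜 : GAlgebraBundle G X A) :
    GBundle 𝒜 ⥤ EquivariantModule.{max u v, max u v, w} G 𝒜.sections where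
  obj E :=
    { carrier := E.sections
      smul_smul := fun g _ _ ↦ Subtype.ext <| funext fun _ ↦ E.act_smul g _ _ _ }
  map {E F} f :=
    { toLinearMap :=
        { toFun := fun s ↦ ⟨fun x ↦ f.toFun x (s.1 x), f.continuous_toFun.comp s.2⟩
          map_add' := fun _ _ ↦ Subtype.ext <| funext fun x ↦ map_add (f.toFun x) _ _
          map_smul' := fun _ _ ↦ Subtype.ext <| funext fun x ↦ (f.toFun x).map_smul _ _ }
      map_smul := fun g _ ↦ Subtype.ext <| funext fun _ ↦ f.map_act g _ _ }

/-! ### Continuity of maps into total spaces -/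

section ContinuityTools

open Bundle

/-! This is a Serre–Swan argument based on dual bases. As X is compact Hausdorff, a partition of
unity glues local dual bases of E into finitely many global linear forms and sections
(`ModuleBundle.exists_frame`). Such a frame exhibits Γ(E) as a retract of Bⁿ. Hence Γ(E) is finitely
generated projective, and its compact-open topology is the module topology
(`compactOpen_eq_moduleTopology`), so continuity of the action passes from E to Γ(E). A section
passes through every vector of E, so Γ is faithful; a B-linear map is recovered fibrewise from its
values on a frame, so Γ is full.

For essential surjectivity, a dual basis of M gives an idempotent matrix q over B, and the rows
fixed by q(x) form the fibre at x of a bundle. Nearby idempotent matrices over the Banach algebra A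
are conjugate, which gives local triviality (`AlgebraBundle.imageFiber_locally_trivial`). The dual
bases need not be G-invariant: the action on the fibres is forced by the one on M (`imageAct_eval`),
and it is continuous because G moves the finitely many generators continuously
(`continuous_imageAct`). -/

/-- A map into a total space that vanishes off a closed set over which it is controlled by a
trivialization is continuous. -/
theorem Bundle.Trivialization.continuous_of_cutoff {X Q P Z : Type*} {F : X → Type*}
    [TopologicalSpace X] [TopologicalSpace (TotalSpace Q F)] [∀ x, Zero (F x)]
    [TopologicalSpace P] [TopologicalSpace Z]
    (hzero : Continuous fun x ↦ (⟨x, 0⟩ : TotalSpace Q F))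
    (f : Trivialization P (TotalSpace.proj : TotalSpace Q F → X)) {p : Z → X} (hp : Continuous p)
    {K : Set X} (hK : IsClosed K) (hKf : K ⊆ f.baseSet) {s : ∀ z, F (p z)}
    (h0 : ∀ z, p z ∉ K → s z = 0)
    (h1 : ∀ z, p z ∈ f.baseSet → ContinuousAt (fun z ↦ (f ⟨p z, s z⟩).2) z) :
    Continuous fun z ↦ (⟨p z, s z⟩ : TotalSpace Q F) := by
  rw [continuous_iff_continuousAt]
  intro z₀
  by_cases hz : p z₀ ∈ f.baseSet
  · refine f.continuousAt_of_comp_left hp.continuousAt hz ?_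
    have h : ContinuousAt (fun z ↦ (p z, (f ⟨p z, s z⟩).2)) z₀ := hp.continuousAt.prodMk (h1 _ hz)
    refine h.congr ?_
    filter_upwards [hp.continuousAt.preimage_mem_nhds (f.open_baseSet.mem_nhds hz)] with z hz
    exact Prod.ext (f.coe_fst (x := ⟨p z, s z⟩) (f.mem_source.2 hz)).symm rfl
  · refine ((hzero.comp hp).continuousAt (x := z₀)).congr ?_
    filter_upwards [hp.continuousAt.preimage_mem_nhds
      (hK.isOpen_compl.mem_nhds fun h ↦ hz (hKf h))] with z hz
    simp [h0 z hz]

theorem Bundle.Trivialization.continuousAt_snd {X Q P Z : Type*} {F : X → Type*}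
    [TopologicalSpace X] [TopologicalSpace (TotalSpace Q F)]
    [TopologicalSpace P] [TopologicalSpace Z]
    (f : Trivialization P (TotalSpace.proj : TotalSpace Q F → X)) {p : Z → X}
    {s : ∀ z, F (p z)} (hs : Continuous fun z ↦ (⟨p z, s z⟩ : TotalSpace Q F)) {z₀ : Z}
    (hz : p z₀ ∈ f.baseSet) : ContinuousAt (fun z ↦ (f ⟨p z, s z⟩).2) z₀ :=
  (ContinuousAt.comp (f := fun z ↦ (⟨p z, s z⟩ : TotalSpace Q F)) (g := f)
    (f.continuousAt (f.mem_source.2 hz)) hs.continuousAt).snd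

variable {X : Type u} [TopologicalSpace X] {A : Type v} [NormedRing A] [NormedAlgebra ℝ A]

/-- Continuity over an arbitrary base map, of a map into the total space that is obtained from
continuous maps by an operation that makes sense in `A`. -/
theorem AlgebraBundle.continuous_of_op (𝒜 : AlgebraBundle X A) {Z ι : Type*} [TopologicalSpace Z]
    {p : Z → X} (hp : Continuous p) {s : ι → ∀ z, 𝒜.Fiber (p z)} {r : ∀ z, 𝒜.Fiber (p z)}
    (hs : ∀ i, Continuous fun z ↦ (⟨p z, s i z⟩ : 𝒜.Total))
    (op : Z → (ι → A) → A) (hop : Continuous fun q : Z × (ι → A) ↦ op q.1 q.2)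
    (hr : ∀ (z : Z) (φ : 𝒜.Fiber (p z) ≃ₐ[ℝ] A), φ (r z) = op z fun i ↦ φ (s i z)) :
    Continuous fun z ↦ (⟨p z, r z⟩ : 𝒜.Total) := by
  rw [continuous_iff_continuousAt]
  intro z₀
  obtain ⟨e, hx₀, he⟩ := 𝒜.locally_trivial (p z₀)
  refine e.continuousAt_of_comp_left hp.continuousAt hx₀ ?_
  have h : ContinuousAt (fun z ↦ (p z, op z fun i ↦ (e ⟨p z, s i z⟩).2)) z₀ :=
    hp.continuousAt.prodMk (ContinuousAt.comp (f := fun z ↦ (z, fun i ↦ (e ⟨p z, s i z⟩).2))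
      hop.continuousAt (continuousAt_id.prodMk
        (continuousAt_pi.2 fun i ↦ e.continuousAt_snd (hs i) hx₀)))
  refine h.congr ?_
  filter_upwards [hp.continuousAt.preimage_mem_nhds (e.open_baseSet.mem_nhds hx₀)] with z hz
  obtain ⟨φ, hφ⟩ := he _ hz
  simp [hφ, hr z φ]

theorem AlgebraBundle.continuous_zero (𝒜 : AlgebraBundle X A) :
    Continuous fun x ↦ (⟨x, 0⟩ : 𝒜.Total) :=
  (0 : 𝒜.sections).2

theorem AlgebraBundle.continuous_mul (𝒜 : AlgebraBundle X A) {Z : Type*} [TopologicalSpace Z]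
    {p : Z → X} (hp : Continuous p) {s t : ∀ z, 𝒜.Fiber (p z)}
    (hs : Continuous fun z ↦ (⟨p z, s z⟩ : 𝒜.Total))
    (ht : Continuous fun z ↦ (⟨p z, t z⟩ : 𝒜.Total)) :
    Continuous fun z ↦ (⟨p z, s z * t z⟩ : 𝒜.Total) :=
  𝒜.continuous_of_op hp (s := fun b : Bool ↦ if b then s else t) (by rintro (_ | _) <;> assumption)
    (fun _ a ↦ a true * a false) (by fun_prop) (by simp)

theorem AlgebraBundle.continuous_sum (𝒜 : AlgebraBundle X A) {Z ι : Type*} [TopologicalSpace Z]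
    {p : Z → X} (hp : Continuous p) (I : Finset ι) {s : ι → ∀ z, 𝒜.Fiber (p z)}
    (hs : ∀ i, Continuous fun z ↦ (⟨p z, s i z⟩ : 𝒜.Total)) :
    Continuous fun z ↦ (⟨p z, ∑ i ∈ I, s i z⟩ : 𝒜.Total) :=
  𝒜.continuous_of_op hp hs (fun _ a ↦ ∑ i ∈ I, a i) (by fun_prop) (by simp)

theorem AlgebraBundle.continuous_add (𝒜 : AlgebraBundle X A) {Z : Type*} [TopologicalSpace Z]
    {p : Z → X} (hp : Continuous p) {s t : ∀ z, 𝒜.Fiber (p z)}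
    (hs : Continuous fun z ↦ (⟨p z, s z⟩ : 𝒜.Total))
    (ht : Continuous fun z ↦ (⟨p z, t z⟩ : 𝒜.Total)) :
    Continuous fun z ↦ (⟨p z, s z + t z⟩ : 𝒜.Total) :=
  𝒜.continuous_of_op hp (s := fun b : Bool ↦ if b then s else t) (by rintro (_ | _) <;> assumption)
    (fun _ a ↦ a true + a false) (by fun_prop) (by simp)

theorem ModuleBundle.continuous_smul_of_base {𝒜 : AlgebraBundle X A} (E : ModuleBundle 𝒜)
    {Z : Type*} [TopologicalSpace Z] {p : Z → X} {b : ∀ z, 𝒜.Fiber (p z)} {s : ∀ z, E.Fiber (p z)}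
    (hb : Continuous fun z ↦ (⟨p z, b z⟩ : 𝒜.Total))
    (hs : Continuous fun z ↦ (⟨p z, s z⟩ : E.Total)) :
    Continuous fun z ↦ (⟨p z, b z • s z⟩ : E.Total) :=
  E.continuous_smul.comp (f := fun z ↦
    (⟨(⟨p z, b z⟩, ⟨p z, s z⟩), rfl⟩ : {p : 𝒜.Total × E.Total // p.2.proj = p.1.proj}))
    ((hb.prodMk hs).subtype_mk _)

theorem ModuleBundle.continuous_sum {𝒜 : AlgebraBundle X A} (E : ModuleBundle 𝒜)
    {Z ι : Type*} [TopologicalSpace Z] {p : Z → X} (hp : Continuous p) (I : Finset ι)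
    {s : ι → ∀ z, E.Fiber (p z)} (hs : ∀ i, Continuous fun z ↦ (⟨p z, s i z⟩ : E.Total)) :
    Continuous fun z ↦ (⟨p z, ∑ i ∈ I, s i z⟩ : E.Total) := by
  rw [continuous_iff_continuousAt]
  intro z₀
  obtain ⟨P, _, _, _, _, e, f, hx₀, hef, h⟩ := E.locally_trivial (p z₀)
  have : ContinuousAdd P := IsModuleTopology.toContinuousAdd A P
  rw [hef] at hx₀ h
  refine f.continuousAt_of_comp_left hp.continuousAt hx₀ ?_
  have hc : ContinuousAt (fun z ↦ (p z, ∑ i ∈ I, (f ⟨p z, s i z⟩).2)) z₀ :=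
    hp.continuousAt.prodMk (tendsto_finsetSum _ fun i _ ↦ f.continuousAt_snd (hs i) hx₀)
  refine hc.congr ?_
  filter_upwards [hp.continuousAt.preimage_mem_nhds (f.open_baseSet.mem_nhds hx₀)] with z hz
  obtain ⟨φ, ψ, -, hψ, -⟩ := h _ hz
  simp [hψ]

theorem ModuleBundle.continuous_add {𝒜 : AlgebraBundle X A} (E : ModuleBundle 𝒜)
    {Z : Type*} [TopologicalSpace Z] {p : Z → X} (hp : Continuous p) {s t : ∀ z, E.Fiber (p z)}
    (hs : Continuous fun z ↦ (⟨p z, s z⟩ : E.Total))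
    (ht : Continuous fun z ↦ (⟨p z, t z⟩ : E.Total)) :
    Continuous fun z ↦ (⟨p z, s z + t z⟩ : E.Total) := by
  refine (E.continuous_sum hp Finset.univ (s := fun b : Bool ↦ if b then s else t)
    (by rintro (_ | _) <;> assumption)).congr fun z ↦ ?_
  simp

/-! ### The compact-open topology on sections -/

/-- A continuous section of an `𝒜`-bundle, as a continuous map from `X` to the total space. -/
def ModuleBundle.sections.toContinuousMap {𝒜 : AlgebraBundle X A} (E : ModuleBundle 𝒜)
    (s : E.sections) : C(X, E.Total) where
  toFun x := ⟨x, s.1 x⟩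
  continuous_toFun := s.2

/-- The compact-open topology on the sections of an `𝒜`-bundle. -/
@[reducible]
def ModuleBundle.sections.compactOpen {𝒜 : AlgebraBundle X A} (E : ModuleBundle 𝒜) :
    TopologicalSpace E.sections :=
  TopologicalSpace.induced (ModuleBundle.sections.toContinuousMap E) inferInstance

variable [LocallyCompactSpace X]

/-- The exponential law: evaluation is continuous because X is locally compact. Every continuity
question about Γ(𝒜) thereby becomes one about the total space, where trivializations apply. -/
theorem AlgebraBundle.sections.continuous_iff (𝒜 : AlgebraBundle X A) {W : Type*}
    [TopologicalSpace W] {f : W → 𝒜.sections} :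
    Continuous f ↔ Continuous fun p : W × X ↦ (⟨p.2, (f p.1).1 p.2⟩ : 𝒜.Total) := by
  rw [continuous_induced_rng]
  constructor
  · intro h
    exact ContinuousEval.continuous_eval.comp (h.prodMap continuous_id)
  · intro h
    exact ContinuousMap.continuous_of_continuous_uncurry _ h

theorem ModuleBundle.sections.continuous_iff {𝒜 : AlgebraBundle X A} (E : ModuleBundle 𝒜)
    {W : Type*} [TopologicalSpace W] {f : W → E.sections} :
    letI := ModuleBundle.sections.compactOpen E
    Continuous f ↔ Continuous fun p : W × X ↦ (⟨p.2, (f p.1).1 p.2⟩ : E.Total) := by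
  let := ModuleBundle.sections.compactOpen E
  refine (continuous_induced_rng (f := ModuleBundle.sections.toContinuousMap E)).trans ?_
  constructor
  · intro h
    exact ContinuousEval.continuous_eval.comp (h.prodMap continuous_id)
  · intro h
    exact ContinuousMap.continuous_of_continuous_uncurry _ h

theorem AlgebraBundle.sections.continuous_eval (𝒜 : AlgebraBundle X A) {W : Type*}
    [TopologicalSpace W] {f : W → 𝒜.sections} (hf : Continuous f) {p : W → X} (hp : Continuous p) :
    Continuous fun w ↦ (⟨p w, (f w).1 (p w)⟩ : 𝒜.Total) :=
  ((sections.continuous_iff 𝒜).1 hf).comp (continuous_id.prodMk hp)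

theorem ModuleBundle.sections.continuous_eval {𝒜 : AlgebraBundle X A} (E : ModuleBundle 𝒜)
    {W : Type*} [TopologicalSpace W] {f : W → E.sections}
    (hf : letI := ModuleBundle.sections.compactOpen E; Continuous f)
    {p : W → X} (hp : Continuous p) :
    Continuous fun w ↦ (⟨p w, (f w).1 (p w)⟩ : E.Total) :=
  ((sections.continuous_iff E).1 hf).comp (continuous_id.prodMk hp)

instance AlgebraBundle.sections.isTopologicalSemiring (𝒜 : AlgebraBundle X A) :
    IsTopologicalSemiring 𝒜.sections where
  continuous_add := (sections.continuous_iff 𝒜).2 <| 𝒜.continuous_add continuous_snd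
    (sections.continuous_eval 𝒜 (continuous_fst.comp continuous_fst) continuous_snd)
    (sections.continuous_eval 𝒜 (continuous_snd.comp continuous_fst) continuous_snd)
  continuous_mul := (sections.continuous_iff 𝒜).2 <| 𝒜.continuous_mul continuous_snd
    (sections.continuous_eval 𝒜 (continuous_fst.comp continuous_fst) continuous_snd)
    (sections.continuous_eval 𝒜 (continuous_snd.comp continuous_fst) continuous_snd)

theorem ModuleBundle.sections.continuousAdd {𝒜 : AlgebraBundle X A} (E : ModuleBundle 𝒜) :
    letI := compactOpen E
    ContinuousAdd E.sections :=
  letI := compactOpen E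
  ⟨(sections.continuous_iff E).2 <| E.continuous_add continuous_snd
    (sections.continuous_eval E (continuous_fst.comp continuous_fst) continuous_snd)
    (sections.continuous_eval E (continuous_snd.comp continuous_fst) continuous_snd)⟩

theorem ModuleBundle.sections.continuousSMul {𝒜 : AlgebraBundle X A} (E : ModuleBundle 𝒜) :
    letI := compactOpen E
    ContinuousSMul 𝒜.sections E.sections :=
  letI := compactOpen E
  ⟨(sections.continuous_iff E).2 <| E.continuous_smul_of_base
    (AlgebraBundle.sections.continuous_eval 𝒜 (continuous_fst.comp continuous_fst) continuous_snd)
    (sections.continuous_eval E (continuous_snd.comp continuous_fst) continuous_snd)⟩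

end ContinuityTools

/-! ### Module topologies and retracts of free modules -/

theorem ModuleTopology.continuous_linearMap {R M N : Type*} [Ring R] [TopologicalSpace R]
    [IsTopologicalSemiring R] [AddCommGroup M] [Module R M] [AddCommGroup N] [Module R N]
    [TopologicalSpace N] [IsModuleTopology R N] (φ : N →ₗ[R] M) :
    @Continuous _ _ _ (moduleTopology R M) φ := by
  let : TopologicalSpace M := moduleTopology R M
  have : ContinuousAdd M := ModuleTopology.continuousAdd R M
  have : ContinuousSMul R M := ModuleTopology.continuousSMul R M
  exact IsModuleTopology.continuous_of_linearMap φ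

/-- A topological module that is a retract of `R ^ n`, by a continuous section and a linear
retraction, carries the module topology. -/
theorem IsModuleTopology.of_retract {R M ι : Type*} [Ring R] [TopologicalSpace R]
    [IsTopologicalSemiring R] [AddCommGroup M] [Module R M] [TopologicalSpace M] [ContinuousAdd M]
    [ContinuousSMul R M] [Finite ι] {i : M → ι → R} (hi : Continuous i) (r : (ι → R) →ₗ[R] M)
    (hr : ∀ m, r (i m) = m) : IsModuleTopology R M := by
  -- It suffices that the identity is continuous from the given topology to the module topology. It
  -- factors as `r ∘ i`, where `r` is continuous into the module topology by linearity.
  refine IsModuleTopology.of_continuous_id ?_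
  have h := @Continuous.comp _ _ _ _ _ (moduleTopology R M) _ _
    (ModuleTopology.continuous_linearMap r) hi
  rwa [show r ∘ i = id from funext hr] at h

/-! ### Finite dual bases from partitions of unity -/

section Frames

variable {X : Type u} [TopologicalSpace X] {A : Type v} [NormedRing A] [NormedAlgebra ℝ A]

/-- A finite dual basis of an `𝒜`-bundle: finitely many continuous linear forms and sections that
restrict to a dual basis of every fibre. -/
structure ModuleBundle.Frame {𝒜 : AlgebraBundle X A} (E : ModuleBundle 𝒜) (ι : Type*)
    [Fintype ι] where
  coord : ι → ∀ x, E.Fiber x →ₗ[𝒜.Fiber x] 𝒜.Fiber x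
  continuous_coord : ∀ k,
    Continuous fun p : E.Total ↦ (⟨p.proj, coord k p.proj p.snd⟩ : 𝒜.Total)
  vec : ι → E.sections
  sum_coord_smul : ∀ x m, ∑ k, coord k x m • (vec k).1 x = m

theorem ModuleBundle.continuous_proj {𝒜 : AlgebraBundle X A} (E : ModuleBundle 𝒜) :
    Continuous (Bundle.TotalSpace.proj : E.Total → X) := by
  rw [continuous_iff_continuousAt]
  intro z
  obtain ⟨P, _, _, _, _, e, f, hx₀, hef, -⟩ := E.locally_trivial z.proj
  exact f.continuousAt_proj (f.mem_source.2 (hef ▸ hx₀))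

theorem AlgebraBundle.continuous_proj (𝒜 : AlgebraBundle X A) :
    Continuous (Bundle.TotalSpace.proj : 𝒜.Total → X) := by
  rw [continuous_iff_continuousAt]
  intro z
  obtain ⟨e, hx₀, -⟩ := 𝒜.locally_trivial z.proj
  exact e.continuousAt_proj (e.mem_source.2 hx₀)

/-- A dual basis of the fibre at x₀, moved to the model P, is constant in the trivialization. Forms
and vectors are both multiplied by ρ so that each extends by zero, whence the factor ρ². On E, real
scalars act through `algebraMap`, since its fibres are modules over the fibres of 𝒜 only. -/
theorem ModuleBundle.exists_local_frame {𝒜 : AlgebraBundle X A} (E : ModuleBundle 𝒜) (x₀ : X) :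
    ∃ U : Set X, IsOpen U ∧ x₀ ∈ U ∧ ∀ ρ : X → ℝ, Continuous ρ → tsupport ρ ⊆ U →
      ∃ (n : ℕ) (coord : Fin n → ∀ x, E.Fiber x →ₗ[𝒜.Fiber x] 𝒜.Fiber x)
        (vec : Fin n → E.sections),
        (∀ k, Continuous fun p : E.Total ↦ (⟨p.proj, coord k p.proj p.snd⟩ : 𝒜.Total)) ∧
        ∀ x m, ∑ k, coord k x m • (vec k).1 x = algebraMap ℝ (𝒜.Fiber x) (ρ x * ρ x) • m := by
  classical
  obtain ⟨P, _, _, _, _, e, f, hx₀, hef, h⟩ := E.locally_trivial x₀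
  rw [hef] at hx₀ h
  choose φ ψ hφ hψ hsmul using h
  have hsymm : ∀ y hy (a : A) (m : P),
      (ψ y hy).symm (a • m) = (φ y hy).symm a • (ψ y hy).symm m := fun y hy a m ↦ by
    apply (ψ y hy).injective
    simp [hsmul]
  -- The model P is not assumed finitely generated projective; it inherits this from the fibre at
  -- x₀.
  have := E.finite x₀
  have := E.projective x₀
  obtain ⟨n, r, i, -, -, hri⟩ :=
    Module.Finite.exists_comp_eq_id_of_projective (𝒜.Fiber x₀) (E.Fiber x₀)
  let Λ : Fin n → P →ₗ[A] A := fun k ↦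
    { toFun := fun m ↦ φ x₀ hx₀ (i ((ψ x₀ hx₀).symm m) k)
      map_add' := by simp
      map_smul' := by simp [hsymm] }
  let σ : Fin n → P := fun k ↦ ψ x₀ hx₀ (r (Pi.single k 1))
  have hΛσ : ∀ m, ∑ k, Λ k m • σ k = m := fun m ↦ by
    simp only [Λ, σ, LinearMap.coe_mk, AddHom.coe_mk, ← hsmul, ← map_sum, ← map_smul]
    have h1 : ∀ v : Fin n → 𝒜.Fiber x₀, ∑ k, v k • (Pi.single k 1 : Fin n → 𝒜.Fiber x₀) = v :=
      fun v ↦ by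
        ext j
        simp [Finset.sum_apply, Pi.single_apply]
    rw [h1]
    have h2 := LinearMap.congr_fun hri ((ψ x₀ hx₀).symm m)
    simp only [LinearMap.comp_apply, LinearMap.id_apply] at h2
    rw [h2]
    simp
  have hΛc : ∀ k, Continuous (Λ k) := fun k ↦ IsModuleTopology.continuous_of_linearMap (Λ k)
  have : ContinuousSMul A P := IsModuleTopology.toContinuousSMul A P
  refine ⟨f.baseSet, f.open_baseSet, hx₀, fun ρ hρ hU ↦ ⟨n, fun k x ↦
    if hx : x ∈ f.baseSet then
      { toFun := fun m ↦ ρ x • (φ x hx).symm (Λ k (ψ x hx m))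
        map_add' := by simp
        map_smul' := by simp [hsmul] }
    else 0, fun k ↦ ⟨fun x ↦ if hx : x ∈ f.baseSet then
      algebraMap ℝ (𝒜.Fiber x) (ρ x) • (ψ x hx).symm (σ k) else 0, ?_⟩, ?_, ?_⟩⟩
  · refine f.continuous_of_cutoff E.continuous_zero_section continuous_id (isClosed_tsupport ρ) hU
      (s := fun x ↦ if hx : x ∈ f.baseSet then
        algebraMap ℝ (𝒜.Fiber x) (ρ x) • (ψ x hx).symm (σ k) else 0) ?_ ?_
    · intro x hx
      have h0 : ρ x = 0 := image_eq_zero_of_notMem_tsupport hx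
      simp [h0]
    · intro x hx
      have hc : ContinuousAt (fun y ↦ algebraMap ℝ A (ρ y) • σ k) x := by fun_prop
      refine hc.congr ?_
      filter_upwards [f.open_baseSet.mem_nhds hx] with y hy
      have hy' : y ∈ f.baseSet := hy
      simp [hy', hψ y hy', hsmul]
  · intro k
    refine e.continuous_of_cutoff 𝒜.continuous_zero E.continuous_proj (isClosed_tsupport ρ)
      (hef ▸ hU) ?_ ?_
    · intro z hz
      have h0 : ρ z.proj = 0 := image_eq_zero_of_notMem_tsupport hz
      by_cases hx : z.proj ∈ f.baseSet <;> simp [h0, hx]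
    · intro z hz
      rw [hef] at hz
      have hc : ContinuousAt (fun z : E.Total ↦ ρ z.proj • Λ k (f z).2) z :=
        (hρ.comp E.continuous_proj).continuousAt.smul ((hΛc k).continuousAt.comp
          (f.continuousAt (f.mem_source.2 hz)).snd)
      refine hc.congr ?_
      filter_upwards [E.continuous_proj.continuousAt.preimage_mem_nhds
        (f.open_baseSet.mem_nhds hz)] with ⟨y, m⟩ hy
      have hy' : y ∈ f.baseSet := hy
      simp [hy', hφ y hy', hψ y hy']
  · intro x m
    by_cases hx : x ∈ f.baseSet
    · simp only [hx, dif_pos, LinearMap.coe_mk, AddHom.coe_mk]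
      apply (ψ x hx).injective
      simp only [map_sum, hsmul, AlgEquiv.apply_symm_apply, AddEquiv.apply_symm_apply, map_smul,
        AlgEquiv.commutes]
      conv_rhs => rw [← hΛσ (ψ x hx m)]
      rw [Finset.smul_sum]
      refine Finset.sum_congr rfl fun k _ ↦ ?_
      -- Real scalars are central in A, so the ρ of the vector moves past the coefficient to join
      -- the ρ of the form.
      rw [smul_smul, smul_smul, Algebra.smul_def, map_mul, mul_assoc, mul_assoc,
        ← Algebra.commutes (ρ x)]
    · have : ρ x = 0 := image_eq_zero_of_notMem_tsupport fun h ↦ hx (hU h)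
      simp [hx, this]

/-- A local frame with cutoff ρ sums to ρ² times the identity. With the square roots of a partition
of unity as cutoffs, the union of the local frames sums to the identity. -/
theorem ModuleBundle.exists_frame [CompactSpace X] [T2Space X] {𝒜 : AlgebraBundle X A}
    (E : ModuleBundle 𝒜) : ∃ n : ℕ, Nonempty (E.Frame (Fin n)) := by
  choose U hUo hxU hU using E.exists_local_frame
  obtain ⟨t, ht⟩ := isCompact_univ.elim_finite_subcover U hUo
    fun x _ ↦ Set.mem_iUnion.2 ⟨x, hxU x⟩
  obtain ⟨ρ, hρ⟩ := PartitionOfUnity.exists_isSubordinate isClosed_univ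
    (fun j : t ↦ U j) (fun j ↦ hUo j) fun x hx ↦ by
      obtain ⟨y, hy, hxy⟩ := Set.mem_iUnion₂.1 (ht hx)
      exact Set.mem_iUnion.2 ⟨⟨y, hy⟩, hxy⟩
  have hs : ∀ j : t, tsupport (fun x ↦ √(ρ j x)) ⊆ U j := fun j ↦
    (closure_mono fun x (hx : √(ρ j x) ≠ 0) (h0 : ρ j x = 0) ↦ hx (by simp [h0])).trans (hρ j)
  choose n coord vec hc hsum using fun j : t ↦
    hU j (fun x ↦ √(ρ j x)) (Real.continuous_sqrt.comp (ρ j).continuous) (hs j)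
  let ε := Fintype.equivFin (Σ j : t, Fin (n j))
  refine ⟨_, ⟨⟨fun k ↦ coord (ε.symm k).1 (ε.symm k).2, fun k ↦ hc _ _,
    fun k ↦ vec (ε.symm k).1 (ε.symm k).2, fun x m ↦ ?_⟩⟩⟩
  rw [ε.symm.sum_comp (fun k ↦ coord k.1 k.2 x m • (vec k.1 k.2).1 x), Fintype.sum_sigma]
  simp only [hsum, Real.mul_self_sqrt (ρ.nonneg _ _), ← Finset.sum_smul, ← map_sum]
  rw [← finsum_eq_sum_of_fintype, ρ.sum_eq_one (Set.mem_univ x), map_one, one_smul]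

end Frames

/-! ### Sections as a finitely generated projective topological module -/

section SectionModule

variable {X : Type u} [TopologicalSpace X] {A : Type v} [NormedRing A] [NormedAlgebra ℝ A]

instance ModuleBundle.sections.instModule {𝒜 : AlgebraBundle X A} (E : ModuleBundle 𝒜) :
    Module 𝒜.sections E.sections :=
  Submodule.module E.sections

instance ModuleBundle.sections.instSMul {𝒜 : AlgebraBundle X A} (E : ModuleBundle 𝒜) :
    SMul 𝒜.sections E.sections :=
  (ModuleBundle.sections.instModule E).toSMul

namespace ModuleBundle.Frame

variable {𝒜 : AlgebraBundle X A} {E : ModuleBundle 𝒜} {ι : Type*} [Fintype ι]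

/-- The coordinates of a section with respect to a frame. -/
def coordSection (Φ : E.Frame ι) : E.sections →ₗ[𝒜.sections] ι → 𝒜.sections where
  toFun s k := ⟨fun x ↦ Φ.coord k x (s.1 x), (Φ.continuous_coord k).comp s.2⟩
  map_add' _ _ := funext fun k ↦ Subtype.ext <| funext fun x ↦ map_add (Φ.coord k x) _ _
  map_smul' _ _ := funext fun k ↦ Subtype.ext <| funext fun x ↦ map_smul (Φ.coord k x) _ _

theorem sum_coordSection_smul (Φ : E.Frame ι) (s : E.sections) :
    ∑ k, Φ.coordSection s k • Φ.vec k = s := by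
  refine Subtype.ext <| funext fun x ↦ ?_
  rw [AddSubmonoidClass.coe_finsetSum, Finset.sum_apply]
  exact Φ.sum_coord_smul x (s.1 x)

theorem linearCombination_comp_coordSection (Φ : E.Frame ι) :
    (Fintype.linearCombination 𝒜.sections Φ.vec).comp Φ.coordSection = LinearMap.id :=
  LinearMap.ext Φ.sum_coordSection_smul

theorem finite_sections (Φ : E.Frame ι) : Module.Finite 𝒜.sections E.sections :=
  Module.Finite.of_surjective (Fintype.linearCombination 𝒜.sections Φ.vec)
    fun s ↦ ⟨Φ.coordSection s, Φ.sum_coordSection_smul s⟩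

theorem projective_sections (Φ : E.Frame ι) : Module.Projective 𝒜.sections E.sections :=
  Module.Projective.of_split _ _ Φ.linearCombination_comp_coordSection

/-- The coordinates are continuous for the compact-open topology, so the frame makes Γ(E) a
topological retract of a finite free module. This links the topology visible on the total space with
the intrinsic one of the module. -/
theorem compactOpen_eq_moduleTopology [LocallyCompactSpace X] (Φ : E.Frame ι) :
    ModuleBundle.sections.compactOpen E = moduleTopology 𝒜.sections E.sections := by
  let := ModuleBundle.sections.compactOpen E
  have := ModuleBundle.sections.continuousAdd E
  have := ModuleBundle.sections.continuousSMul E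
  have : IsModuleTopology 𝒜.sections E.sections :=
    IsModuleTopology.of_retract (i := Φ.coordSection)
      (continuous_pi fun k ↦ (AlgebraBundle.sections.continuous_iff 𝒜).2 <|
        (Φ.continuous_coord k).comp
          (ModuleBundle.sections.continuous_eval E continuous_fst continuous_snd))
      (Fintype.linearCombination 𝒜.sections Φ.vec) Φ.sum_coordSection_smul
  exact eq_moduleTopology 𝒜.sections E.sections

end ModuleBundle.Frame

variable [CompactSpace X] [T2Space X]

/-- A section constant in a trivialization around x is cut off by a Urysohn function with value 1 at
x. -/
theorem AlgebraBundle.exists_section_eq (𝒜 : AlgebraBundle X A) (x : X) (a : 𝒜.Fiber x) :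
    ∃ b : 𝒜.sections, b.1 x = a := by
  classical
  obtain ⟨e, hx, he⟩ := 𝒜.locally_trivial x
  choose φ hφ using he
  obtain ⟨ρ, hρ, h1, -⟩ := exists_tsupport_one_of_isOpen_isClosed e.open_baseSet
    isClosed_closure.isCompact (isClosed_singleton (x := x)) (Set.singleton_subset_iff.2 hx)
  have h1 : ρ x = 1 := h1 rfl
  refine ⟨⟨fun y ↦ if hy : y ∈ e.baseSet then ρ y • (φ y hy).symm (φ x hx a) else 0, ?_⟩, ?_⟩
  · refine e.continuous_of_cutoff 𝒜.continuous_zero continuous_id (isClosed_tsupport ρ) hρ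
      (s := fun y ↦ if hy : y ∈ e.baseSet then ρ y • (φ y hy).symm (φ x hx a) else 0) ?_ ?_
    · intro y hy
      have h0 : ρ y = 0 := image_eq_zero_of_notMem_tsupport hy
      simp [h0]
    · intro y hy
      have hc : ContinuousAt (fun y ↦ ρ y • φ x hx a) y := by fun_prop
      refine hc.congr ?_
      filter_upwards [e.open_baseSet.mem_nhds hy] with z hz
      have hz' : z ∈ e.baseSet := hz
      simp [hz', hφ z hz']
  · simp [hx, h1]

/-- A frame reduces this to 𝒜: the coordinates of m extend to sections of 𝒜. -/
theorem ModuleBundle.exists_section_eq {𝒜 : AlgebraBundle X A} (E : ModuleBundle 𝒜) (x : X)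
    (m : E.Fiber x) : ∃ s : E.sections, s.1 x = m := by
  obtain ⟨n, ⟨Φ⟩⟩ := E.exists_frame
  choose b hb using fun k ↦ 𝒜.exists_section_eq x (Φ.coord k x m)
  refine ⟨∑ k, b k • Φ.vec k, ?_⟩
  rw [AddSubmonoidClass.coe_finsetSum, Finset.sum_apply]
  refine Eq.trans ?_ (Φ.sum_coord_smul x m)
  refine Finset.sum_congr rfl fun k _ ↦ ?_
  rw [← hb k]
  rfl

end SectionModule

/-! ### Continuity of the action on sections; faithfulness and fullness -/

section SectionsFunctor

variable {G : Type w} [Group G] [TopologicalSpace G] {X : Type u} [TopologicalSpace X]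
  [MulAction G X] [ContinuousSMul G X] {A : Type v} [NormedRing A] [NormedAlgebra ℝ A]

theorem GBundle.act_smul_section {𝒜 : GAlgebraBundle G X A} (E : GBundle 𝒜) (g : G) {x y : X}
    (h : g • x = y) (s : E.sections) : (g • s).1 y = E.act g h (s.1 x) :=
  E.act_congr rfl (by simp [← h]) _ _ s.1

variable [IsTopologicalGroup G] [CompactSpace X] [T2Space X]

/-- By the exponential law it suffices that (g, s, x) ↦ g (s (g⁻¹ x)) is continuous, and this is
built from inversion, evaluation and the action on E. -/
theorem GBundle.continuous_smul_sections {𝒜 : GAlgebraBundle G X A} (E : GBundle 𝒜) :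
    letI := ModuleBundle.sections.compactOpen E.toModuleBundle
    Continuous fun p : G × E.sections ↦ p.1 • p.2 := by
  let := ModuleBundle.sections.compactOpen E.toModuleBundle
  refine (ModuleBundle.sections.continuous_iff E.toModuleBundle).2 ?_
  have hbase : Continuous fun q : (G × E.sections) × X ↦ q.1.1⁻¹ • q.2 := by fun_prop
  have h := E.continuous_act.comp
    ((continuous_fst.comp continuous_fst : Continuous fun q : (G × E.sections) × X ↦ q.1.1).prodMk
      (ModuleBundle.sections.continuous_eval E.toModuleBundle
        (continuous_snd.comp continuous_fst : Continuous fun q : (G × E.sections) × X ↦ q.1.2)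
        hbase))
  refine h.congr fun ⟨⟨g, s⟩, x⟩ ↦ ?_
  -- The points g g⁻¹ x and x are equal only propositionally; a free endpoint `y` makes the
  -- comparison definitional.
  have key : ∀ (y : X) (hy : g • g⁻¹ • x = y),
      (⟨g • g⁻¹ • x, E.act g rfl (s.1 (g⁻¹ • x))⟩ : E.Total) =
        ⟨y, E.act g hy (s.1 (g⁻¹ • x))⟩ := by
    rintro y rfl; rfl
  exact key x (smul_inv_smul g x)

theorem GBundle.isFGProjectiveContinuous_sections {𝒜 : GAlgebraBundle G X A} (E : GBundle 𝒜) :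
    EquivariantModule.IsFGProjectiveContinuous G 𝒜.sections
      ((GBundle.sectionsFunctor 𝒜).obj E) := by
  obtain ⟨n, ⟨Φ⟩⟩ := E.toModuleBundle.exists_frame
  refine ⟨Φ.finite_sections, Φ.projective_sections, ?_⟩
  have h := E.continuous_smul_sections
  rw [Φ.compactOpen_eq_moduleTopology] at h
  exact h

instance GBundle.sectionsFunctor_faithful (𝒜 : GAlgebraBundle G X A) :
    (GBundle.sectionsFunctor 𝒜).Faithful where
  map_injective {E F f f'} h := by
    refine GBundle.Hom.ext (funext fun x ↦ LinearMap.ext fun m ↦ ?_)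
    obtain ⟨s, rfl⟩ := E.exists_section_eq x m
    have h1 := congrArg (fun l : EquivariantModule.Hom _ _ ↦ l.toLinearMap s) h
    exact congrFun (congrArg Subtype.val h1) x

/-- Expanding s in a frame shows that (f s)(x) depends only on s(x), through the map `T x`.
Continuity of `T` is clear from its formula, and equivariance is checked on a section through the
given vector. -/
instance GBundle.sectionsFunctor_full (𝒜 : GAlgebraBundle G X A) :
    (GBundle.sectionsFunctor 𝒜).Full where
  map_surjective {E F} f := by
    obtain ⟨n, ⟨Φ⟩⟩ := E.toModuleBundle.exists_frame
    let f' : E.sections →ₗ[𝒜.sections] F.sections := f.toLinearMap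
    let T : ∀ x, E.Fiber x →ₗ[𝒜.Fiber x] F.Fiber x := fun x ↦
      ∑ k, (Φ.coord k x).smulRight ((f' (Φ.vec k)).1 x)
    have hT : ∀ x (s : E.sections), T x (s.1 x) = (f' s).1 x := fun x s ↦ by
      conv_rhs => rw [← Φ.sum_coordSection_smul s]
      rw [map_sum, AddSubmonoidClass.coe_finsetSum, Finset.sum_apply]
      simp only [map_smul, T, LinearMap.sum_apply]
      rfl
    refine ⟨GBundle.Hom.mk T ?_ ?_, ?_⟩
    · simp only [T, LinearMap.sum_apply, LinearMap.smulRight_apply]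
      exact F.continuous_sum E.continuous_proj _ fun k ↦ F.continuous_smul_of_base
        (Φ.continuous_coord k) ((f' (Φ.vec k)).2.comp E.continuous_proj)
    · intro g x y h m
      obtain ⟨s, rfl⟩ := E.exists_section_eq x m
      rw [hT, ← E.act_smul_section g h s, hT, ← F.act_smul_section g h]
      exact congrFun (congrArg Subtype.val (f.map_smul g s)) y
    · exact EquivariantModule.Hom.ext (LinearMap.ext fun s ↦ Subtype.ext <| funext fun x ↦ hT x s)

end SectionsFunctor

/-! ### Idempotent matrices, their images and their conjugacy -/

section FixedRows

open Matrix

variable {n : Type*} [Fintype n]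

/-- The row vectors fixed by right multiplication with a square matrix. -/
def Matrix.fixedRows {R : Type*} [Ring R] (q : Matrix n n R) : Submodule R (n → R) where
  carrier := {v | v ᵥ* q = v}
  add_mem' {v w} hv hw := by
    change (v + w) ᵥ* q = v + w
    rw [add_vecMul, hv, hw]
  zero_mem' := zero_vecMul q
  smul_mem' a v hv := by
    change (a • v) ᵥ* q = a • v
    rw [smul_vecMul, hv]

theorem Matrix.mem_fixedRows {R : Type*} [Ring R] {q : Matrix n n R} {v : n → R} :
    v ∈ q.fixedRows ↔ v ᵥ* q = v := Iff.rfl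

/-- The projection onto the fixed row vectors of an idempotent matrix. -/
def Matrix.fixedRowsProj {R : Type*} [Ring R] {q : Matrix n n R} (hq : q * q = q) :
    (n → R) →ₗ[R] q.fixedRows where
  toFun v := ⟨v ᵥ* q, by rw [mem_fixedRows, vecMul_vecMul, hq]⟩
  map_add' v w := Subtype.ext (add_vecMul q v w)
  map_smul' a v := Subtype.ext (smul_vecMul a v q)

theorem Matrix.fixedRowsProj_coe {R : Type*} [Ring R] {q : Matrix n n R} (hq : q * q = q)
    (v : q.fixedRows) : fixedRowsProj hq v.1 = v := Subtype.ext v.2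

theorem Matrix.finite_fixedRows {R : Type*} [Ring R] {q : Matrix n n R} (hq : q * q = q) :
    Module.Finite R q.fixedRows :=
  Module.Finite.of_surjective (fixedRowsProj hq) fun v ↦ ⟨v.1, fixedRowsProj_coe hq v⟩

theorem Matrix.projective_fixedRows {R : Type*} [Ring R] {q : Matrix n n R} (hq : q * q = q) :
    Module.Projective R q.fixedRows :=
  Module.Projective.of_split q.fixedRows.subtype (fixedRowsProj hq)
    (LinearMap.ext (fixedRowsProj_coe hq))

theorem Matrix.isModuleTopology_fixedRows {R : Type*} [Ring R] [TopologicalSpace R]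
    [IsTopologicalSemiring R] {q : Matrix n n R} (hq : q * q = q) :
    IsModuleTopology R q.fixedRows :=
  have : ContinuousAdd q.fixedRows := q.fixedRows.toAddSubmonoid.continuousAdd
  IsModuleTopology.of_retract continuous_subtype_val (fixedRowsProj hq) (fixedRowsProj_coe hq)

/-- Matrices that correspond to each other under a ring isomorphism and conjugation have
isomorphic spaces of fixed row vectors. -/
def Matrix.fixedRowsEquiv [DecidableEq n] {R S : Type*} [Ring R] [Ring S] (φ : R ≃+* S)
    {q : Matrix n n R} {q' u u' : Matrix n n S} (huu' : u * u' = 1) (hu'u : u' * u = 1)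
    (h : q.map φ * u = u * q') : q.fixedRows ≃+ q'.fixedRows where
  toFun v := ⟨(φ ∘ v.1) ᵥ* u, by
    have hv : (φ ∘ v.1) ᵥ* q.map φ = φ ∘ v.1 := funext fun k ↦ by
      rw [Function.comp_apply, ← congrFun (mem_fixedRows.1 v.2) k]
      exact ((φ : R →+* S).map_vecMul q v.1 k).symm
    rw [mem_fixedRows, vecMul_vecMul, ← h, ← vecMul_vecMul, hv]⟩
  invFun w := ⟨φ.symm ∘ (w.1 ᵥ* u'), by
    -- This is the relation `h` multiplied by `u'` on both sides.
    have h' : u' * q.map φ = q' * u' := by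
      rw [← mul_one (u' * _), ← huu', ← mul_assoc, mul_assoc u', h, ← mul_assoc u', hu'u, one_mul]
    have hw : (w.1 ᵥ* u') ᵥ* q.map φ = w.1 ᵥ* u' := by
      rw [vecMul_vecMul, h', ← vecMul_vecMul, mem_fixedRows.1 w.2]
    rw [mem_fixedRows]
    refine funext fun k ↦ φ.injective ?_
    refine ((φ : R →+* S).map_vecMul q _ k).trans ?_
    have : (φ : R →+* S) ∘ φ.symm ∘ (w.1 ᵥ* u') = w.1 ᵥ* u' := by ext; simp
    rw [this]
    simpa using congrFun hw k⟩
  left_inv v := Subtype.ext <| funext fun k ↦ by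
    simp [vecMul_vecMul, huu']
  right_inv w := Subtype.ext <| funext fun k ↦ by
    have : φ ∘ φ.symm ∘ (w.1 ᵥ* u') = w.1 ᵥ* u' := by ext; simp
    simp [this, vecMul_vecMul, hu'u]
  map_add' v w := Subtype.ext <| by
    have : φ ∘ (v + w).1 = φ ∘ v.1 + φ ∘ w.1 := by ext; simp
    simp only [this, add_vecMul]
    rfl

theorem Matrix.fixedRowsEquiv_smul [DecidableEq n] {R S : Type*} [Ring R] [Ring S] (φ : R ≃+* S)
    {q : Matrix n n R} {q' u u' : Matrix n n S} (huu' : u * u' = 1) (hu'u : u' * u = 1)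
    (h : q.map φ * u = u * q') (a : R) (v : q.fixedRows) :
    fixedRowsEquiv φ huu' hu'u h (a • v) = φ a • fixedRowsEquiv φ huu' hu'u h v :=
  Subtype.ext <| by
    have : φ ∘ (a • v).1 = φ a • (φ ∘ v.1) := by ext; simp
    change (φ ∘ (a • v).1) ᵥ* u = φ a • ((φ ∘ v.1) ᵥ* u)
    rw [this, smul_vecMul]

/-- The standard element that conjugates two idempotents when it is invertible. -/
theorem IsIdempotentElem.mul_conjugator {R : Type*} [Ring R] {p q : R} (hp : p * p = p)
    (hq : q * q = q) :
    p * (p * q + (1 - p) * (1 - q)) = (p * q + (1 - p) * (1 - q)) * q := by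
  -- Once the cross terms vanish, both sides equal `p * q`.
  have h1 : p * (1 - p) = 0 := by rw [mul_sub, hp, mul_one, sub_self]
  have h2 : (1 - q) * q = 0 := by rw [sub_mul, hq, one_mul, sub_self]
  rw [mul_add, add_mul, ← mul_assoc, ← mul_assoc, h1, hp, mul_assoc, mul_assoc, hq, h2]
  simp

section Units

variable {A : Type*} [NormedRing A] [CompleteSpace A] [DecidableEq n]

/-- Matrices over a complete normed ring form a complete normed ring for the ℓ^∞ operator norm,
whose uniformity is the entrywise one. Hence the Neumann series argument, giving openness of the
units and continuity of inversion, applies in the entrywise topology. -/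
theorem Matrix.hasSummableGeomSeries :
    @HasSummableGeomSeries (Matrix n n A) Matrix.linftyOpNormedRing :=
  let : NormedRing (Matrix n n A) := Matrix.linftyOpNormedRing
  have : @CompleteSpace (Matrix n n A)
      Matrix.linftyOpNormedRing.toMetricSpace.toPseudoMetricSpace.toUniformSpace :=
    Matrix.instCompleteSpace (m := n) (n := n) (𝕜 := A)
  inferInstance

theorem Matrix.isOpen_isUnit : IsOpen {M : Matrix n n A | IsUnit M} :=
  @Units.isOpen _ Matrix.linftyOpNormedRing Matrix.hasSummableGeomSeries

theorem Matrix.continuousAt_inverse {M : Matrix n n A} (hM : IsUnit M) :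
    ContinuousAt (Ring.inverse : Matrix n n A → Matrix n n A) M := by
  obtain ⟨u, rfl⟩ := hM
  exact @NormedRing.inverse_continuousAt _ Matrix.linftyOpNormedRing
    Matrix.hasSummableGeomSeries u

end Units

end FixedRows

/-! ### The bundle of images of an idempotent matrix over Γ(𝒜) -/

section ImageBundle

open Matrix Bundle

/-- A local trivialization from continuous families of bijections of the fibres with the model. -/
noncomputable def Bundle.Trivialization.ofEquiv {X Q P : Type*} {F : X → Type*} [TopologicalSpace X]
    [TopologicalSpace (TotalSpace Q F)] [TopologicalSpace P] [∀ x, Zero (F x)] [Zero P]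
    (hproj : Continuous (TotalSpace.proj : TotalSpace Q F → X)) {V : Set X} (hV : IsOpen V)
    (ψ : ∀ x ∈ V, F x ≃ P)
    (h₁ : Continuous fun z : {z : TotalSpace Q F // z.proj ∈ V} ↦ ψ z.1.proj z.2 z.1.snd)
    (h₂ : Continuous fun w : V × P ↦
      (⟨w.1.1, (ψ w.1.1 w.1.2).symm w.2⟩ : TotalSpace Q F)) :
    Trivialization P (TotalSpace.proj : TotalSpace Q F → X) :=
  open scoped Classical in
  { toFun := fun z ↦ (z.proj, if h : z.proj ∈ V then ψ _ h z.snd else 0)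
    invFun := fun w ↦ ⟨w.1, if h : w.1 ∈ V then (ψ _ h).symm w.2 else 0⟩
    source := TotalSpace.proj ⁻¹' V
    target := V ×ˢ Set.univ
    map_source' := fun z hz ↦ ⟨hz, trivial⟩
    map_target' := fun w hw ↦ hw.1
    left_inv' := by
      rintro ⟨x, m⟩ hx
      have hx' : x ∈ V := hx
      simp [hx']
    right_inv' := by
      rintro ⟨x, m⟩ hx
      have hx' : x ∈ V := hx.1
      simp [hx']
    continuousOn_toFun := by
      refine hproj.continuousOn.prodMk ?_
      rw [continuousOn_iff_continuous_domRestrict]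
      refine h₁.congr fun z ↦ ?_
      have hz : z.1.proj ∈ V := z.2
      simp [hz]
    continuousOn_invFun := by
      rw [continuousOn_iff_continuous_domRestrict]
      have h : Continuous fun w : (V ×ˢ Set.univ : Set (X × P)) ↦
          ((⟨w.1.1, w.2.1⟩, w.1.2) : V × P) := by fun_prop
      refine (h₂.comp h).congr fun w ↦ ?_
      have hw : w.1.1 ∈ V := w.2.1
      simp [hw]
    open_source := hV.preimage hproj
    open_target := hV.prod isOpen_univ
    baseSet := V
    open_baseSet := hV
    source_eq := rfl
    target_eq := rfl
    proj_toFun := fun _ _ ↦ rfl }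

theorem Bundle.Trivialization.ofEquiv_apply {X Q P : Type*} {F : X → Type*} [TopologicalSpace X]
    [TopologicalSpace (TotalSpace Q F)] [TopologicalSpace P] [∀ x, Zero (F x)] [Zero P]
    (hproj : Continuous (TotalSpace.proj : TotalSpace Q F → X)) {V : Set X} (hV : IsOpen V)
    (ψ : ∀ x ∈ V, F x ≃ P)
    (h₁ : Continuous fun z : {z : TotalSpace Q F // z.proj ∈ V} ↦ ψ z.1.proj z.2 z.1.snd)
    (h₂ : Continuous fun w : V × P ↦
      (⟨w.1.1, (ψ w.1.1 w.1.2).symm w.2⟩ : TotalSpace Q F)) {x : X} (hx : x ∈ V) (m : F x) :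
    Trivialization.ofEquiv hproj hV ψ h₁ h₂ ⟨x, m⟩ = (x, ψ x hx m) := by
  change (x, _) = _
  simp [hx]

variable {X : Type u} [TopologicalSpace X] {A : Type v} [NormedRing A] [NormedAlgebra ℝ A]

/-- Evaluation of sections at a point. -/
def AlgebraBundle.sections.eval (𝒜 : AlgebraBundle X A) (x : X) : 𝒜.sections →+* 𝒜.Fiber x :=
  (Pi.evalRingHom 𝒜.Fiber x).comp 𝒜.sections.subtype

variable {𝒜 : AlgebraBundle X A} {n : ℕ}

/-- The fibre at `x` of the image of a square matrix over `Γ(𝒜)`. -/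
def AlgebraBundle.ImageFiber (q : Matrix (Fin n) (Fin n) 𝒜.sections) (x : X) : Type v :=
  (q.map (sections.eval 𝒜 x)).fixedRows

namespace AlgebraBundle.ImageFiber

variable (q : Matrix (Fin n) (Fin n) 𝒜.sections)

instance (x : X) : AddCommGroup (ImageFiber q x) :=
  inferInstanceAs (AddCommGroup (q.map (sections.eval 𝒜 x)).fixedRows)

instance (x : X) : Module (𝒜.Fiber x) (ImageFiber q x) :=
  inferInstanceAs (Module (𝒜.Fiber x) (q.map (sections.eval 𝒜 x)).fixedRows)

/-- The separate coordinate in X keeps the projection continuous also when n = 0. -/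
instance : TopologicalSpace (TotalSpace Unit (ImageFiber q)) :=
  TopologicalSpace.induced
    (fun z ↦ (z.proj, fun k ↦ (⟨z.proj, z.snd.1 k⟩ : 𝒜.Total)) :
      TotalSpace Unit (ImageFiber q) → X × (Fin n → 𝒜.Total)) inferInstance

variable {q}

theorem continuous_iff {Z : Type*} [TopologicalSpace Z]
    {f : Z → TotalSpace Unit (ImageFiber q)} :
    Continuous f ↔ Continuous (fun z ↦ (f z).proj) ∧
      ∀ k, Continuous fun z ↦ (⟨(f z).proj, (f z).snd.1 k⟩ : 𝒜.Total) := by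
  rw [continuous_induced_rng, ← continuous_pi_iff]
  exact continuous_prodMk

theorem continuous_proj :
    Continuous (TotalSpace.proj : TotalSpace Unit (ImageFiber q) → X) :=
  (continuous_iff.1 continuous_id).1

theorem continuous_coe (k : Fin n) :
    Continuous fun z : TotalSpace Unit (ImageFiber q) ↦ (⟨z.proj, z.snd.1 k⟩ : 𝒜.Total) :=
  (continuous_iff.1 continuous_id).2 k

end AlgebraBundle.ImageFiber

variable {q : Matrix (Fin n) (Fin n) 𝒜.sections}

theorem AlgebraBundle.map_eval_mul_self (hq : q * q = q) (x : X) :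
    q.map (sections.eval 𝒜 x) * q.map (sections.eval 𝒜 x) = q.map (sections.eval 𝒜 x) := by
  rw [← Matrix.map_mul, hq]

/-- In a trivialization of 𝒜, q becomes a continuous family `p` of idempotents over A. The matrix `c
x` intertwines `p x` with `p x₀` and equals 1 at x₀, so it is invertible near x₀, where right
multiplication by it identifies the fixed rows of `p x` with those of `p x₀`. -/
theorem AlgebraBundle.imageFiber_locally_trivial [CompleteSpace A] (hq : q * q = q) (x₀ : X) :
    ∃ (P : Type v) (_ : AddCommGroup P) (_ : Module A P) (_ : TopologicalSpace P)
      (_ : IsModuleTopology A P)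
      (e : Bundle.Trivialization A (Bundle.TotalSpace.proj : 𝒜.Total → X))
      (f : Bundle.Trivialization P
        (Bundle.TotalSpace.proj : TotalSpace Unit (ImageFiber q) → X)),
      x₀ ∈ e.baseSet ∧ e.baseSet = f.baseSet ∧
      ∀ y ∈ e.baseSet, ∃ (φ : 𝒜.Fiber y ≃ₐ[ℝ] A) (ψ : ImageFiber q y ≃+ P),
        (∀ a : 𝒜.Fiber y, e ⟨y, a⟩ = (y, φ a)) ∧ (∀ m : ImageFiber q y, f ⟨y, m⟩ = (y, ψ m)) ∧
        ∀ (a : 𝒜.Fiber y) (m : ImageFiber q y), ψ (a • m) = φ a • ψ m := by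
  obtain ⟨e, hx₀, he⟩ := 𝒜.locally_trivial x₀
  choose φ hφ using he
  -- The chart `e` is used because continuity in x can be read off from it; the `φ x` are chosen
  -- point by point, and only over the base set.
  let p : X → Matrix (Fin n) (Fin n) A := fun x ↦ Matrix.of fun l k ↦ (e ⟨x, (q l k).1 x⟩).2
  have hpφ : ∀ x hx, p x = (q.map (sections.eval 𝒜 x)).map (φ x hx) := fun x hx ↦ by
    ext l k
    simp only [p, of_apply, hφ x hx]
    rfl
  have hp : ∀ x ∈ e.baseSet, p x * p x = p x := fun x hx ↦ by
    rw [hpφ x hx, ← Matrix.map_mul, map_eval_mul_self hq]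
  have hpc : ContinuousOn p e.baseSet := fun x hx ↦
    (continuousAt_pi.2 fun l ↦ continuousAt_pi.2 fun k ↦
      e.continuousAt_snd (q l k).2 hx).continuousWithinAt
  let c : X → Matrix (Fin n) (Fin n) A := fun x ↦ p x * p x₀ + (1 - p x) * (1 - p x₀)
  have hcc : ContinuousOn c e.baseSet :=
    (show Continuous fun m : Matrix (Fin n) (Fin n) A ↦ m * p x₀ + (1 - m) * (1 - p x₀) by
      fun_prop).comp_continuousOn hpc
  have hc₀ : c x₀ = 1 := by
    simp only [c, sub_mul, mul_sub, hp x₀ hx₀, mul_one, one_mul]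
    abel
  have hconj : ∀ x hx, (q.map (sections.eval 𝒜 x)).map (φ x hx) * c x = c x * p x₀ :=
    fun x hx ↦ by
      rw [← hpφ x hx]
      exact IsIdempotentElem.mul_conjugator (hp x hx) (hp x₀ hx₀)
  let V : Set X := e.baseSet ∩ c ⁻¹' {M | IsUnit M}
  have hV : IsOpen V := hcc.isOpen_inter_preimage e.open_baseSet Matrix.isOpen_isUnit
  let ψ : ∀ x ∈ V, ImageFiber q x ≃+ (p x₀).fixedRows := fun x hx ↦
    Matrix.fixedRowsEquiv (φ x hx.1).toRingEquiv (Ring.mul_inverse_cancel _ hx.2)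
      (Ring.inverse_mul_cancel _ hx.2) (hconj x hx.1)
  have hψ₁ : Continuous fun z : {z : TotalSpace Unit (ImageFiber q) // z.proj ∈ V} ↦
      ψ z.1.proj z.2 z.1.snd := by
    refine Continuous.subtype_mk (Continuous.matrix_vecMul (continuous_pi fun k ↦ ?_) ?_) _
    · have h : Continuous fun z : {z : TotalSpace Unit (ImageFiber q) // z.proj ∈ V} ↦
          (e ⟨z.1.proj, z.1.snd.1 k⟩).2 := by
        rw [continuous_iff_continuousAt]
        exact fun z ↦ e.continuousAt_snd
          ((ImageFiber.continuous_coe k).comp continuous_subtype_val) z.2.1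
      refine h.congr fun z ↦ ?_
      rw [hφ _ z.2.1]
      rfl
    · exact hcc.comp_continuous (ImageFiber.continuous_proj.comp continuous_subtype_val)
        fun z ↦ z.2.1
  have hψ₂ : Continuous fun w : V × (p x₀).fixedRows ↦
      (⟨w.1.1, (ψ w.1.1 w.1.2).symm w.2⟩ : TotalSpace Unit (ImageFiber q)) := by
    refine ImageFiber.continuous_iff.2 ⟨continuous_subtype_val.comp continuous_fst, fun k ↦ ?_⟩
    have hi : Continuous fun w : V × (p x₀).fixedRows ↦
        (w.2.1 ᵥ* Ring.inverse (c w.1.1)) k := by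
      refine (continuous_apply k).comp (Continuous.matrix_vecMul
        (continuous_subtype_val.comp continuous_snd) ?_)
      rw [continuous_iff_continuousAt]
      intro w
      refine ContinuousAt.comp (f := fun w : V × (p x₀).fixedRows ↦ c w.1.1)
        (Matrix.continuousAt_inverse w.1.2.2) (Continuous.continuousAt ?_)
      exact hcc.comp_continuous (continuous_subtype_val.comp continuous_fst) fun z ↦ z.1.2.1
    -- Entrywise, the inverse of `ψ` is the inverse chart of 𝒜 applied to the row multiplied by `(c
    -- x)⁻¹`.
    have h := e.continuousOn_symm.comp_continuous
      ((continuous_subtype_val.comp continuous_fst).prodMk hi) fun w ↦ ⟨w.1.2.1, trivial⟩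
    refine h.congr fun w ↦ ?_
    have hw := e.symm_apply_apply_mk w.1.2.1
      ((φ _ w.1.2.1).symm ((w.2.1 ᵥ* Ring.inverse (c w.1.1)) k))
    rw [hφ _ w.1.2.1, AlgEquiv.apply_symm_apply] at hw
    exact congrArg (TotalSpace.mk (F := A) w.1.1) hw
  refine ⟨(p x₀).fixedRows, inferInstance, inferInstance, inferInstance,
    Matrix.isModuleTopology_fixedRows (hp x₀ hx₀), e.restrOpen V hV,
    Trivialization.ofEquiv ImageFiber.continuous_proj hV (fun x hx ↦ (ψ x hx).toEquiv) hψ₁ hψ₂,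
    ⟨hx₀, hx₀, ?_⟩, ?_, ?_⟩
  · simp [hc₀]
  · exact Set.inter_eq_right.2 Set.inter_subset_left
  · rintro y ⟨-, hy⟩
    exact ⟨φ y hy.1, ψ y hy, hφ y hy.1, Trivialization.ofEquiv_apply _ _ _ _ _ hy,
      Matrix.fixedRowsEquiv_smul _ _ _ _⟩

/-- The image of an idempotent matrix over `Γ(𝒜)`, as an `𝒜`-bundle. -/
def AlgebraBundle.imageBundle [CompleteSpace A] (hq : q * q = q) : ModuleBundle 𝒜 where
  Fiber := ImageFiber q
  locally_trivial := imageFiber_locally_trivial hq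
  continuous_smul := by
    have hb : Continuous fun w : {p : 𝒜.Total × TotalSpace Unit (ImageFiber q) //
        p.2.proj = p.1.proj} ↦ w.1.1.proj :=
      𝒜.continuous_proj.comp (continuous_fst.comp continuous_subtype_val)
    refine ImageFiber.continuous_iff.2 ⟨hb, fun k ↦ 𝒜.continuous_mul hb ?_ ?_⟩
    · exact continuous_fst.comp continuous_subtype_val
    · refine ((ImageFiber.continuous_coe k).comp
        (continuous_snd.comp continuous_subtype_val)).congr ?_
      rintro ⟨⟨⟨x, a⟩, ⟨y, m⟩⟩, h⟩
      obtain rfl : y = x := h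
      rfl
  finite x := Matrix.finite_fixedRows (map_eval_mul_self hq x)
  projective x := Matrix.projective_fixedRows (map_eval_mul_self hq x)

end ImageBundle

/-! ### Reconstruction of a bundle from a module; essential surjectivity -/

section EssSurj

open Matrix Bundle

variable {G : Type w} [Group G] [TopologicalSpace G] {X : Type u} [TopologicalSpace X]
  [MulAction G X] [ContinuousSMul G X] {A : Type v} [NormedRing A] [NormedAlgebra ℝ A]

theorem GAlgebraBundle.act_smul_section (𝒜 : GAlgebraBundle G X A) (g : G) {x y : X}
    (h : g • x = y) (b : 𝒜.sections) : (g • b).1 y = 𝒜.act g h (b.1 x) :=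
  𝒜.act_congr rfl (by simp [← h]) _ _ b.1

/-- A dual basis of a module over `Γ(𝒜)`, with index set `Fin n`. -/
structure AlgebraBundle.DualBasis (𝒜 : AlgebraBundle X A) (M : Type*) [AddCommGroup M]
    [Module 𝒜.sections M] (n : ℕ) where
  coord : M →ₗ[𝒜.sections] Fin n → 𝒜.sections
  vec : Fin n → M
  sum_coord_smul : ∀ m, ∑ l, coord m l • vec l = m

namespace AlgebraBundle.DualBasis

variable {𝒜 : AlgebraBundle X A} {M : Type*} [AddCommGroup M] [Module 𝒜.sections M] {n : ℕ}
  (D : 𝒜.DualBasis M n)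

/-- The idempotent matrix of a dual basis. -/
def matrix : Matrix (Fin n) (Fin n) 𝒜.sections := Matrix.of fun l ↦ D.coord (D.vec l)

/-- Row l of the matrix is the coordinate vector of the l-th generator. So expanding in the
generators and taking coordinates again is right multiplication by the matrix; it fixes all
coordinate vectors, and idempotency follows. -/
theorem coord_sum_smul (b : Fin n → 𝒜.sections) :
    D.coord (∑ l, b l • D.vec l) = b ᵥ* D.matrix := by
  rw [map_sum]
  ext1 k
  simp only [map_smul, Finset.sum_apply, vecMul, dotProduct, matrix, of_apply, Pi.smul_apply,
    smul_eq_mul]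

theorem coord_vecMul_matrix (m : M) : D.coord m ᵥ* D.matrix = D.coord m := by
  rw [← D.coord_sum_smul, D.sum_coord_smul]

theorem matrix_mul_self : D.matrix * D.matrix = D.matrix := by
  ext1 l k
  exact congrFun (D.coord_vecMul_matrix (D.vec l)) k

theorem coord_injective : Function.Injective D.coord := fun m m' h ↦ by
  rw [← D.sum_coord_smul m, h, D.sum_coord_smul]

theorem eval_vecMul (b : Fin n → 𝒜.sections) (x : X) :
    (fun k ↦ (b k).1 x) ᵥ* D.matrix.map (sections.eval 𝒜 x) =
      fun k ↦ ((b ᵥ* D.matrix) k).1 x :=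
  funext fun k ↦ ((sections.eval 𝒜 x).map_vecMul D.matrix b k).symm

/-- The value of a module element at a point. -/
def eval (x : X) : M →+ ImageFiber D.matrix x where
  toFun m := ⟨fun k ↦ (D.coord m k).1 x, by
    rw [mem_fixedRows, D.eval_vecMul, D.coord_vecMul_matrix]⟩
  map_zero' := Subtype.ext <| by
    simp only [map_zero]
    rfl
  map_add' m m' := Subtype.ext <| by
    simp only [map_add]
    rfl

theorem eval_smul (x : X) (b : 𝒜.sections) (m : M) :
    D.eval x (b • m) = b.1 x • D.eval x m :=
  Subtype.ext <| funext fun k ↦ by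
    change (D.coord (b • m) k).1 x = _
    rw [map_smul]
    rfl

/-- The entries of a fixed row extend to sections of 𝒜, used as coefficients of the generators.
Taking coordinates multiplies by the matrix, which at x leaves the row unchanged. -/
theorem eval_surjective [CompactSpace X] [T2Space X] (x : X) :
    Function.Surjective (D.eval x) := fun v ↦ by
  choose b hb using fun k ↦ 𝒜.exists_section_eq x (v.1 k)
  refine ⟨∑ l, b l • D.vec l, Subtype.ext ?_⟩
  change (fun k ↦ (D.coord (∑ l, b l • D.vec l) k).1 x) = v.1
  rw [D.coord_sum_smul, ← D.eval_vecMul, funext hb]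
  exact v.2

end AlgebraBundle.DualBasis

namespace GAlgebraBundle

variable {𝒜 : GAlgebraBundle G X A} {M : EquivariantModule.{max u v, max u v, w} G 𝒜.sections}
  {n : ℕ} (D : 𝒜.toAlgebraBundle.DualBasis M.carrier n)

/-- The action of `G` on the image bundle that is induced by the action on the module. -/
def imageAct (g : G) {x y : X} (h : g • x = y) :
    AlgebraBundle.ImageFiber D.matrix x →+ AlgebraBundle.ImageFiber D.matrix y where
  -- The formula is forced by expanding g m in the vectors g • `vec l`. It involves only the entries
  -- of `v`, so no lift of `v` to M is chosen.
  toFun v := ∑ l, 𝒜.act g h (v.1 l) • D.eval y (g • D.vec l)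
  map_zero' := by
    refine Finset.sum_eq_zero fun l _ ↦ ?_
    rw [show (0 : AlgebraBundle.ImageFiber D.matrix x).1 l = 0 from rfl, map_zero, zero_smul]
  map_add' v v' := by
    rw [← Finset.sum_add_distrib]
    refine Finset.sum_congr rfl fun l _ ↦ ?_
    rw [show (v + v').1 l = v.1 l + v'.1 l from rfl, map_add, add_smul]

/-- As every fibre vector is the value of a module element, this reduces the group laws on the
fibres to those of M. -/
theorem imageAct_eval (g : G) {x y : X} (h : g • x = y) (m : M.carrier) :
    imageAct D g h (D.eval x m) = D.eval y (g • m) := by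
  change ∑ l, 𝒜.act g h ((D.coord m l).1 x) • D.eval y (g • D.vec l) = _
  conv_rhs => rw [← D.sum_coord_smul m, Finset.smul_sum, map_sum]
  refine Finset.sum_congr rfl fun l _ ↦ ?_
  rw [M.smul_smul, D.eval_smul, 𝒜.act_smul_section g h]

theorem imageAct_smul (g : G) {x y : X} (h : g • x = y) (a : 𝒜.Fiber x)
    (v : AlgebraBundle.ImageFiber D.matrix x) :
    imageAct D g h (a • v) = 𝒜.act g h a • imageAct D g h v := by
  change ∑ l : Fin n, _ = 𝒜.act g h a • ∑ l : Fin n, _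
  rw [Finset.smul_sum]
  refine Finset.sum_congr rfl fun l _ ↦ ?_
  rw [show (a • v).1 l = a * v.1 l from rfl, map_mul, mul_smul]

theorem imageAct_one [CompactSpace X] [T2Space X] {x : X} (h : (1 : G) • x = x)
    (v : AlgebraBundle.ImageFiber D.matrix x) : imageAct D 1 h v = v := by
  obtain ⟨m, rfl⟩ := D.eval_surjective x v
  rw [imageAct_eval, one_smul]

theorem imageAct_mul [CompactSpace X] [T2Space X] (g₁ g₂ : G) {x y z : X} (h₂ : g₂ • x = y)
    (h₁ : g₁ • y = z) (h : (g₁ * g₂) • x = z) (v : AlgebraBundle.ImageFiber D.matrix x) :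
    imageAct D (g₁ * g₂) h v = imageAct D g₁ h₁ (imageAct D g₂ h₂ v) := by
  obtain ⟨m, rfl⟩ := D.eval_surjective x v
  rw [imageAct_eval, imageAct_eval, imageAct_eval, mul_smul]

/-- Each entry of g v is a sum of products. One factor is the action on 𝒜; the other is a coordinate
of g • `vec l` evaluated at g x. The latter varies continuously because the action on M is
continuous and linear coordinates are automatically continuous for the module topology. -/
theorem continuous_imageAct [CompactSpace X] [T2Space X]
    (hM : letI : TopologicalSpace M.carrier := moduleTopology 𝒜.sections M.carrier
      Continuous fun p : G × M.carrier ↦ p.1 • p.2) :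
    Continuous fun p : G × TotalSpace Unit (AlgebraBundle.ImageFiber D.matrix) ↦
      (⟨p.1 • p.2.proj, imageAct D p.1 rfl p.2.snd⟩ :
        TotalSpace Unit (AlgebraBundle.ImageFiber D.matrix)) := by
  have hb : Continuous fun p : G × TotalSpace Unit (AlgebraBundle.ImageFiber D.matrix) ↦
      p.1 • p.2.proj :=
    continuous_fst.smul (AlgebraBundle.ImageFiber.continuous_proj.comp continuous_snd)
  refine AlgebraBundle.ImageFiber.continuous_iff.2 ⟨hb, fun k ↦ ?_⟩
  have hsum : ∀ p : G × TotalSpace Unit (AlgebraBundle.ImageFiber D.matrix),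
      (imageAct D p.1 rfl p.2.snd).1 k = ∑ l, 𝒜.act p.1 rfl (p.2.snd.1 l) *
        (D.coord (p.1 • D.vec l) k).1 (p.1 • p.2.proj) := fun p ↦ by
    let κ : AlgebraBundle.ImageFiber D.matrix (p.1 • p.2.proj) →+ 𝒜.Fiber (p.1 • p.2.proj) :=
      { toFun := fun v ↦ v.1 k
        map_zero' := rfl
        map_add' := fun _ _ ↦ rfl }
    exact map_sum κ _ _
  simp only [hsum]
  refine 𝒜.continuous_sum hb _ fun l ↦ 𝒜.continuous_mul hb ?_ ?_
  · exact 𝒜.continuous_act.comp (continuous_fst.prodMk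
      ((AlgebraBundle.ImageFiber.continuous_coe l).comp continuous_snd))
  · refine AlgebraBundle.sections.continuous_eval 𝒜.toAlgebraBundle
      (f := fun p : G × TotalSpace Unit (AlgebraBundle.ImageFiber D.matrix) ↦
        D.coord (p.1 • D.vec l) k) ?_ hb
    let : TopologicalSpace M.carrier := moduleTopology 𝒜.sections M.carrier
    have : IsModuleTopology 𝒜.sections M.carrier := ⟨rfl⟩
    have hk : Continuous fun m : M.carrier ↦ D.coord m k :=
      IsModuleTopology.continuous_of_linearMap ((LinearMap.proj k).comp D.coord)
    exact hk.comp (hM.comp (continuous_fst.prodMk continuous_const))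

/-- The `G`–`𝒜` bundle associated with a finitely generated projective `Γ(𝒜)`-module with a
continuous action of `G`. -/
def imageGBundle [CompactSpace X] [T2Space X] [CompleteSpace A]
    (hM : letI : TopologicalSpace M.carrier := moduleTopology 𝒜.sections M.carrier
      Continuous fun p : G × M.carrier ↦ p.1 • p.2) : GBundle 𝒜 where
  toModuleBundle := AlgebraBundle.imageBundle D.matrix_mul_self
  act g _ _ h := imageAct D g h
  act_one h v := imageAct_one D h v
  act_mul g₁ g₂ _ _ _ h₂ h₁ h v := imageAct_mul D g₁ g₂ h₂ h₁ h v
  act_smul g _ _ h a v := imageAct_smul D g h a v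
  continuous_act := continuous_imageAct D hM

variable [CompactSpace X] [T2Space X] [CompleteSpace A]
    (hM : letI : TopologicalSpace M.carrier := moduleTopology 𝒜.sections M.carrier
      Continuous fun p : G × M.carrier ↦ p.1 • p.2)

/-- A module element, as a section of the associated bundle. -/
def toImageSections : M.carrier →ₗ[𝒜.sections] (imageGBundle D hM).sections where
  toFun m := ⟨fun x ↦ D.eval x m, AlgebraBundle.ImageFiber.continuous_iff.2
    ⟨continuous_id, fun k ↦ (D.coord m k).2⟩⟩
  map_add' m m' := Subtype.ext <| funext fun x ↦ map_add (D.eval x) m m'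
  map_smul' b m := Subtype.ext <| funext fun x ↦ D.eval_smul x b m

/-- Coordinates are determined pointwise, which gives injectivity. Conversely, the entries of a
section of the image bundle form a row over Γ(𝒜) fixed by the matrix, as this can be tested at each
point; so it is the coordinate vector of an element of M. -/
theorem toImageSections_bijective : Function.Bijective (toImageSections D hM) := by
  constructor
  · intro m m' h
    refine D.coord_injective (funext fun k ↦ Subtype.ext <| funext fun x ↦ ?_)
    have h1 : D.eval x m = D.eval x m' := congrFun (congrArg Subtype.val h) x
    exact congrFun (congrArg Subtype.val h1) k
  · intro s
    have hs := (AlgebraBundle.ImageFiber.continuous_iff.1 s.2).2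
    let b : Fin n → 𝒜.sections := fun k ↦ ⟨fun x ↦ (s.1 x).1 k, hs k⟩
    have hb : b ᵥ* D.matrix = b := funext fun k ↦ Subtype.ext <| funext fun x ↦
      (congrFun (D.eval_vecMul b x) k).symm.trans (congrFun (s.1 x).2 k)
    refine ⟨∑ l, b l • D.vec l, Subtype.ext <| funext fun x ↦ Subtype.ext <| funext fun k ↦ ?_⟩
    change (D.coord (∑ l, b l • D.vec l) k).1 x = _
    rw [D.coord_sum_smul, hb]

theorem toImageSections_smul (g : G) (m : M.carrier) :
    toImageSections D hM (g • m) = g • toImageSections D hM m :=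
  Subtype.ext <| funext fun x ↦ (imageAct_eval D g (smul_inv_smul g x)
    (x := g⁻¹ • x) m).symm

end GAlgebraBundle

/-- A bijective equivariant linear map is an isomorphism. -/
noncomputable def EquivariantModule.isoOfBijective {B : Type u} [Ring B] [MulSemiringAction G B]
    {M N : EquivariantModule.{u, v, w} G B} (f : M ⟶ N)
    (hf : Function.Bijective f.toLinearMap) : M ≅ N where
  hom := f
  inv :=
    { toLinearMap := (LinearEquiv.ofBijective f.toLinearMap hf).symm
      map_smul := fun g m ↦ hf.1 <| by
        rw [f.map_smul]
        have h := (LinearEquiv.ofBijective f.toLinearMap hf).apply_symm_apply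
        exact (h _).trans (congrArg (g • ·) (h m).symm) }
  hom_inv_id := EquivariantModule.Hom.ext <| LinearMap.ext
    (LinearEquiv.ofBijective f.toLinearMap hf).symm_apply_apply
  inv_hom_id := EquivariantModule.Hom.ext <| LinearMap.ext
    (LinearEquiv.ofBijective f.toLinearMap hf).apply_symm_apply

theorem AlgebraBundle.exists_dualBasis (𝒜 : AlgebraBundle X A) (M : Type*) [AddCommGroup M]
    [Module 𝒜.sections M] [Module.Finite 𝒜.sections M] [Module.Projective 𝒜.sections M] :
    ∃ n, Nonempty (𝒜.DualBasis M n) := by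
  obtain ⟨n, r, i, -, -, hri⟩ := Module.Finite.exists_comp_eq_id_of_projective 𝒜.sections M
  refine ⟨n, ⟨⟨i, fun l ↦ r (Pi.single l 1), fun m ↦ ?_⟩⟩⟩
  simp only [← map_smul, ← map_sum]
  conv_rhs => rw [← LinearMap.id_apply (R := 𝒜.sections) m, ← hri, LinearMap.comp_apply]
  congr 1
  exact (pi_eq_sum_univ' (i m)).symm

theorem GBundle.sectionsFunctor_lift_essSurj [CompactSpace X] [T2Space X] [CompleteSpace A]
    (𝒜 : GAlgebraBundle G X A)
    (h : ∀ E : GBundle 𝒜, EquivariantModule.IsFGProjectiveContinuous G 𝒜.sections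
      ((GBundle.sectionsFunctor 𝒜).obj E)) :
    ((EquivariantModule.IsFGProjectiveContinuous G 𝒜.sections).lift
      (GBundle.sectionsFunctor 𝒜) h).EssSurj where
  mem_essImage := fun ⟨M, hfin, hproj, hM⟩ ↦ by
    obtain ⟨n, ⟨D⟩⟩ := 𝒜.exists_dualBasis M.carrier
    let f : M ⟶ (GBundle.sectionsFunctor 𝒜).obj (GAlgebraBundle.imageGBundle D hM) :=
      { toLinearMap := GAlgebraBundle.toImageSections D hM
        map_smul := GAlgebraBundle.toImageSections_smul D hM }
    refine ⟨GAlgebraBundle.imageGBundle D hM, ⟨?_⟩⟩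
    -- The target is a full subcategory, so an isomorphism of the underlying equivariant modules
    -- suffices.
    exact (ObjectProperty.fullyFaithfulι _).preimageIso (EquivariantModule.isoOfBijective f
      (GAlgebraBundle.toImageSections_bijective D hM)).symm

end EssSurj

theorem mainTheorem7
    -- a compact Lie group `G`
    {V : Type t} [NormedAddCommGroup V] [NormedSpace ℝ V] [FiniteDimensional ℝ V]
    {G : Type w} [Group G] [TopologicalSpace G] [ChartedSpace V G] [LieGroup 𝓘(ℝ, V) ∞ G]
    [CompactSpace G]
    -- a compact Hausdorff `G`-space `X`
    {X : Type u} [TopologicalSpace X] [CompactSpace X] [T2Space X]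
    [MulAction G X] [ContinuousSMul G X]
    -- a unital Banach `ℝ`-algebra `A`, and an algebra bundle `𝒜` on `X` with fibre `A` and a
    -- `G`-action
    {A : Type v} [NormedRing A] [NormedAlgebra ℝ A] [CompleteSpace A]
    (𝒜 : GAlgebraBundle G X A) :
    ∃ h : ∀ E : GBundle 𝒜, EquivariantModule.IsFGProjectiveContinuous G 𝒜.sections
        ((GBundle.sectionsFunctor 𝒜).obj E),
      ((EquivariantModule.IsFGProjectiveContinuous G 𝒜.sections).lift
        (GBundle.sectionsFunctor 𝒜) h).IsEquivalence := by
  -- Continuity of inversion enters because the action on sections involves g⁻¹ x.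
  have : IsTopologicalGroup G := topologicalGroup_of_lieGroup 𝓘(ℝ, V) ∞
  have h := fun E : GBundle 𝒜 ↦ E.isFGProjectiveContinuous_sections
  have := GBundle.sectionsFunctor_lift_essSurj 𝒜 h
  -- Faithfulness and fullness of the lift are inherited from Γ by instance search.
  exact ⟨h, { }⟩
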